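/- Let $R$ be a commutative Noetherian ring and let $A$ be an $R$-algebra that is finitely generated and projective as an $R$-module. Write $R\text{-proj}$ for the category of finitely generated projective $R$-modules and $D=\operatorname{Hom}_R(-,R)$, which maps left $A$-modules to right $A$-modules (left $A^{op}$-modules). For a family $\theta=\{\theta(\lambda)\}_{\lambda\in\Lambda}$ of finitely generated $A$-modules indexed by a poset $\Lambda$, let $\mathcal F(\tilde\theta)$ be the category of $A$-modules having a finite filtration with factors isomorphic to $\theta(\lambda)\otimes_R U$ with $\lambda\in\Lambda$ and $U\in R\text{-proj}$. The pair $(A,\{\Delta(\lambda)\}_{\lambda\in\Lambda})$ is called split quasi-hereditary if: 1. each $\Delta(\lambda)$ is a finitely generated $A$-module that is projective over $R$; 2. $\operatorname{Hom}_A(\Delta(\lambda),\Delta(\mu))\neq 0$ implies $\lambda\le\mu$; 3. $\operatorname{End}_A(\Delta(\lambda))\simeq R$ for all $\lambda$; 4. for each $\lambda$ there are a finitely generated projective $A$-module $P(\lambda)$ and an exact sequence $0\to C(\lambda)\to P(\lambda)\to\Delta(\lambda)\to 0$ such that $C(\lambda)$ has a finite filtration with factors of the form $\Delta(\mu)\otimes_R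 U$, with $\mu>\lambda$ and $U\in R\text{-proj}$; 5. the modules $P(\lambda)$ can be chosen so that the direct summands of finite direct sums of copies of $\bigoplus_\lambda P(\lambda)$ are exactly the finitely generated projective $A$-modules. Its costandard modules are the finitely generated $A$-modules $\nabla(\lambda)$, $\lambda\in\Lambda$, such that $(A^{op},\{D\nabla(\lambda)\}_{\lambda\in\Lambda})$ is split quasi-hereditary (with the same order on $\Lambda$), $\operatorname{Hom}_A(\Delta(\lambda),\nabla(\lambda))\simeq R$ as $R$-modules, $\operatorname{Hom}_A(\Delta(\lambda),\nabla(\mu))=0$ for $\lambda\ne\mu$, and $\operatorname{Ext}^i_A(\Delta(\lambda),\nabla(\mu))=0$ for all $\lambda,\mu$ and $i>0$. Let $(A,\{\Delta(\lambda)\}_{\lambda\in\Lambda})$ be split quasi-hereditary with costandard modules $\{\nabla(\lambda)\}_{\lambda\in\Lambda}$. Let $M\in\mathcal F(\tilde\Delta)$ and $N\in\mathcal F(\tilde\nabla)$, and let $\mathcal F(D\tilde\nabla)$ be the category of right $A$-modules having a finite filtration with factors isomorphic to $D\nabla(\lambda)\otimes_R U$, with $\lambda\in\Lambda$ and $U\in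 R\text{-proj}$. Then: - $DN\otimes_A M\in R\text{-proj}$, and $\operatorname{Tor}^A_i(DN,M)=0$ for all $i>0$. - The functor $-\otimes_A M\colon\mathcal F(D\tilde\nabla)\to R\text{-proj}$ is well defined and exact: it sends every object of $\mathcal F(D\tilde\nabla)$ to a finitely generated projective $R$-module, and short exact sequences of right $A$-modules with all terms in $\mathcal F(D\tilde\nabla)$ to short exact sequences. - The functor $DN\otimes_A-\colon\mathcal F(\tilde\Delta)\to R\text{-proj}$ is well defined and exact, in the same sense. - For every commutative $R$-algebra $Q$ that is a Noetherian ring, the canonical map $$Q\otimes_R\operatorname{Hom}_A(M,N)\to\operatorname{Hom}_{Q\otimes_R A}(Q\otimes_R M,\,Q\otimes_R N),\qquad q\otimes f\mapsto\bigl(q'\otimes m\mapsto qq'\otimes f(m)\bigr),$$ is an isomorphism of $Q$-modules. -/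

import Mathlib

open CategoryTheory MulOpposite
open scoped TensorProduct DirectSum

universe u v w

namespace SplitQH

section Restrict

/-- A module over an `R`-algebra `A` is an `R`-module through `R → A`.  The priority is low, so that
for objects of `ModuleCat R` the given `R`-module structure is always the one that is found. -/
instance (priority := 10) restrictModule {R : Type w} {A : Type u} [CommRing R] [Ring A]
    [Algebra R A] (M : ModuleCat.{v} A) : Module R M :=
  Module.compHom M (algebraMap R A)

instance (priority := 10) restrict_isScalarTower {R : Type w} {A : Type u} [CommRing R] [Ring A]
    [Algebra R A] (M : ModuleCat.{v} A) : IsScalarTower R A M where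
  smul_assoc r a m := by
    change (r • a) • m = algebraMap R A r • (a • m)
    rw [Algebra.smul_def, mul_smul]

end Restrict

section Filtrations

/-- `M` has a filtration `M = F 0 ⊇ F 1 ⊇ ⋯ ⊇ F t = 0` by `A`-submodules all of whose
factors `F i / F (i + 1)` belong to the class `θ`. -/
def HasFiltration {A : Type u} [Ring A] (θ : ObjectProperty (ModuleCat.{u} A))
    (M : ModuleCat.{u} A) : Prop :=
  ∃ (t : ℕ) (F : ℕ → Submodule A M), F 0 = ⊤ ∧ F t = ⊥ ∧
    ∀ i < t, F (i + 1) ≤ F i ∧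
      θ (ModuleCat.of A (F i ⧸ (F (i + 1)).submoduleOf (F i)))

/-- The class of the `A`-modules isomorphic to `Δ l ⊗[R] U`, with `l ∈ Γ` and `U` a finitely
generated projective `R`-module. -/
def tildeOn (R : Type u) {A : Type u} [CommRing R] [Ring A] [Algebra R A] {Λ : Type v}
    (Δ : Λ → ModuleCat.{u} A) (Γ : Set Λ) : ObjectProperty (ModuleCat.{u} A) :=
  fun X => ∃ l ∈ Γ, ∃ (U : Type u) (_ : AddCommGroup U) (_ : Module R U),
    Module.Finite R U ∧ Module.Projective R U ∧ Nonempty (X ≃ₗ[A] (Δ l ⊗[R] U))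

/-- The `A`-modules with a finite filtration whose factors are of the form `Δ l ⊗[R] U`, with `U` a
finitely generated projective `R`-module. -/
def Filt (R : Type u) {A : Type u} [CommRing R] [Ring A] [Algebra R A] {Λ : Type v}
    (Δ : Λ → ModuleCat.{u} A) : ObjectProperty (ModuleCat.{u} A) :=
  HasFiltration (tildeOn R Δ Set.univ)

/-- `X` lies in the additive closure of `M`: it is a direct summand of some `Mⁿ`. -/
def InAdd (A : Type u) [Ring A] (M : Type w) [AddCommGroup M] [Module A M]
    (X : ModuleCat.{u} A) : Prop :=
  ∃ (n : ℕ) (i : X →ₗ[A] (Fin n → M)) (p : (Fin n → M) →ₗ[A] X), p ∘ₗ i = LinearMap.id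

end Filtrations

/-- `(A, {Δ l})` is a split quasi-hereditary `R`-algebra (for `A` finitely generated and projective
as an `R`-module). -/
structure IsSplitQuasiHereditary (R : Type u) (A : Type u) [CommRing R] [Ring A] [Algebra R A]
    {Λ : Type v} [PartialOrder Λ] (Δ : Λ → ModuleCat.{u} A) : Prop where
  finite : ∀ l, Module.Finite A (Δ l)
  projective : ∀ l, Module.Projective R (Δ l)
  le_of_hom_ne_zero : ∀ (l m : Λ) (f : Δ l →ₗ[A] Δ m), f ≠ 0 → l ≤ m
  end_equiv : ∀ l, Nonempty (R ≃ₐ[R] Module.End A (Δ l))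
  exists_projectives : ∃ P : Λ → ModuleCat.{u} A,
    (∀ l, Module.Finite A (P l) ∧ Module.Projective A (P l) ∧
      ∃ π : P l →ₗ[A] Δ l, Function.Surjective π ∧
        HasFiltration (tildeOn R Δ {m | l < m}) (ModuleCat.of A (LinearMap.ker π))) ∧
    ∀ X : ModuleCat.{u} A,
      InAdd A (⨁ l, P l) X ↔ Module.Finite A X ∧ Module.Projective A X

section Dual

/-- The action of `Aᵐᵒᵖ` on `Hom_R(N, R)`: `(f · a) n = f (a n)`. -/
@[reducible] def dualModule (R : Type u) {A : Type u} [CommRing R] [Ring A] [Algebra R A]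
    (N : ModuleCat.{u} A) : Module Aᵐᵒᵖ (N →ₗ[R] R) where
  smul a f := f ∘ₗ Algebra.lsmul R R N a.unop
  one_smul f := by
    apply LinearMap.ext; intro n
    change f ((1 : A) • n) = f n
    rw [one_smul]
  mul_smul a b f := by
    apply LinearMap.ext; intro n
    change f ((b.unop * a.unop) • n) = f (b.unop • a.unop • n)
    rw [mul_smul]
  smul_zero a := rfl
  smul_add a f g := rfl
  add_smul a b f := by
    apply LinearMap.ext; intro n
    change f ((a.unop + b.unop) • n) = f (a.unop • n) + f (b.unop • n)
    rw [add_smul, map_add]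
  zero_smul f := by
    apply LinearMap.ext; intro n
    change f ((0 : A) • n) = 0
    rw [zero_smul, map_zero]

/-- The dual `D N = Hom_R(N, R)` of a left `A`-module, a right `A`-module, that is, a left module
over the opposite algebra `Aᵐᵒᵖ`. -/
def dual (R : Type u) {A : Type u} [CommRing R] [Ring A] [Algebra R A]
    (N : ModuleCat.{u} A) : ModuleCat.{u} Aᵐᵒᵖ :=
  letI := dualModule R N
  ModuleCat.of Aᵐᵒᵖ (N →ₗ[R] R)

end Dual

/-- `{∇ l}` is the family of costandard modules (it is unique up to isomorphism) of the split
quasi-hereditary algebra `(A, {Δ l})`. -/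
structure IsCostandard (R : Type u) (A : Type u) [CommRing R] [Ring A] [Algebra R A]
    {Λ : Type v} [PartialOrder Λ] (Δ nabla : Λ → ModuleCat.{u} A) : Prop where
  finite : ∀ l, Module.Finite A (nabla l)
  dual_splitQuasiHereditary : IsSplitQuasiHereditary R Aᵐᵒᵖ (fun l => dual R (nabla l))
  hom_self : ∀ l, Nonempty ((Δ l →ₗ[A] nabla l) ≃ₗ[R] R)
  hom_of_ne : ∀ l m, l ≠ m → Subsingleton (Δ l →ₗ[A] nabla m)
  ext_vanish : ∀ (l m : Λ) (i : ℕ), 0 < i → Subsingleton (Abelian.Ext (Δ l) (nabla m) i)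

section Tensor

variable (R : Type u) {A : Type u} [CommRing R] [Ring A] [Algebra R A]

/-- The relations `x a ⊗ y = x ⊗ a y`. -/
def balanced (X : ModuleCat.{u} Aᵐᵒᵖ) (Y : ModuleCat.{u} A) : Submodule R (X ⊗[R] Y) :=
  Submodule.span R
    {z | ∃ (x : X) (a : A) (y : Y), z = (op a • x) ⊗ₜ[R] y - x ⊗ₜ[R] (a • y)}

/-- The tensor product `X ⊗_A Y` of a right and a left `A`-module, as an `R`-module. -/
def tensorOver (X : ModuleCat.{u} Aᵐᵒᵖ) (Y : ModuleCat.{u} A) : ModuleCat.{u} R :=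
  ModuleCat.of R ((X ⊗[R] Y) ⧸ balanced R X Y)

variable {R} in
theorem balanced_le_comap {X X' : ModuleCat.{u} Aᵐᵒᵖ} {Y Y' : ModuleCat.{u} A}
    (f : X →ₗ[Aᵐᵒᵖ] X') (g : Y →ₗ[A] Y') :
    balanced R X Y ≤ (balanced R X' Y').comap
      (TensorProduct.map (f.restrictScalars R) (g.restrictScalars R)) := by
  refine Submodule.span_le.2 ?_
  rintro _ ⟨x, a, y, rfl⟩
  refine Submodule.subset_span ⟨f x, a, g y, ?_⟩
  simp

/-- The map `f ⊗_A g`. -/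
def tensorMap {X X' : ModuleCat.{u} Aᵐᵒᵖ} {Y Y' : ModuleCat.{u} A}
    (f : X →ₗ[Aᵐᵒᵖ] X') (g : Y →ₗ[A] Y') : tensorOver R X Y ⟶ tensorOver R X' Y' :=
  ModuleCat.ofHom (Submodule.mapQ (balanced R X Y) (balanced R X' Y')
    (TensorProduct.map (f.restrictScalars R) (g.restrictScalars R)) (balanced_le_comap f g))

/-- The class of `x ⊗ y` in `X ⊗_A Y`. -/
def tensorMk {X : ModuleCat.{u} Aᵐᵒᵖ} {Y : ModuleCat.{u} A} (x : X) (y : Y) : tensorOver R X Y :=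
  Submodule.Quotient.mk (p := balanced R X Y) (x ⊗ₜ[R] y)

theorem tensorMap_mk {X X' : ModuleCat.{u} Aᵐᵒᵖ} {Y Y' : ModuleCat.{u} A}
    (f : X →ₗ[Aᵐᵒᵖ] X') (g : Y →ₗ[A] Y') (x : X) (y : Y) :
    (tensorMap R f g).hom (tensorMk R x y) = tensorMk R (f x) (g y) := rfl

variable {R} in
theorem tensor_hom_ext {X : ModuleCat.{u} Aᵐᵒᵖ} {Y : ModuleCat.{u} A} {Z : ModuleCat.{u} R}
    {f g : tensorOver R X Y ⟶ Z}
    (h : ∀ x y, f.hom (tensorMk R x y) = g.hom (tensorMk R x y)) : f = g := by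
  apply ModuleCat.hom_ext
  apply Submodule.linearMap_qext
  apply TensorProduct.ext'
  exact h

theorem tensorMk_add_left {X : ModuleCat.{u} Aᵐᵒᵖ} {Y : ModuleCat.{u} A} (x x' : X) (y : Y) :
    tensorMk R (x + x') y = tensorMk R x y + tensorMk R x' y := by
  unfold tensorMk
  rw [TensorProduct.add_tmul]
  rfl

theorem tensorMk_add_right {X : ModuleCat.{u} Aᵐᵒᵖ} {Y : ModuleCat.{u} A} (x : X) (y y' : Y) :
    tensorMk R x (y + y') = tensorMk R x y + tensorMk R x y' := by
  unfold tensorMk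
  rw [TensorProduct.tmul_add]
  rfl

/-- The functor `X ⊗_A -` from left `A`-modules to `R`-modules. -/
def tensorLeft (X : ModuleCat.{u} Aᵐᵒᵖ) : ModuleCat.{u} A ⥤ ModuleCat.{u} R where
  obj Y := tensorOver R X Y
  map g := tensorMap R LinearMap.id g.hom
  map_id _ := tensor_hom_ext fun _ _ => rfl
  map_comp _ _ := tensor_hom_ext fun _ _ => rfl

/-- The functor `- ⊗_A Y` from right `A`-modules to `R`-modules. -/
def tensorRight (Y : ModuleCat.{u} A) : ModuleCat.{u} Aᵐᵒᵖ ⥤ ModuleCat.{u} R where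
  obj X := tensorOver R X Y
  map f := tensorMap R f.hom LinearMap.id
  map_id _ := tensor_hom_ext fun _ _ => rfl
  map_comp _ _ := tensor_hom_ext fun _ _ => rfl

instance tensorLeft_additive (X : ModuleCat.{u} Aᵐᵒᵖ) : (tensorLeft R X).Additive where
  map_add := tensor_hom_ext fun _ _ => tensorMk_add_right R _ _ _

instance tensorRight_additive (Y : ModuleCat.{u} A) : (tensorRight R Y).Additive where
  map_add := tensor_hom_ext fun _ _ => tensorMk_add_left R _ _ _

/-- `Tor_i^A(X, Y)`: the `i`-th left derived functor of `X ⊗_A -`, evaluated at `Y`. -/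
noncomputable def tor (i : ℕ) (X : ModuleCat.{u} Aᵐᵒᵖ) (Y : ModuleCat.{u} A) : ModuleCat.{u} R :=
  ((tensorLeft R X).leftDerived i).obj Y

end Tensor

/-- The functor `F` restricts to a well-defined exact functor from the full subcategory `P` of
`ModuleCat B` to the category of finitely generated projective `R`-modules: it maps `P` to finitely
generated projective modules, and short exact sequences with terms in `P` to short exact
sequences. -/
def IsExactToProj {R : Type u} [CommRing R] {B : Type u} [Ring B]
    (P : ObjectProperty (ModuleCat.{u} B)) (F : ModuleCat.{u} B ⥤ ModuleCat.{u} R)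
    [F.Additive] : Prop :=
  (∀ X, P X → Module.Finite R (F.obj X) ∧ Module.Projective R (F.obj X)) ∧
  ∀ S : ShortComplex (ModuleCat.{u} B), S.ShortExact → P S.X₁ → P S.X₂ → P S.X₃ →
    (S.map F).ShortExact

section BaseChange

variable {R : Type u} {A : Type u} [CommRing R] [Ring A] [Algebra R A]

/-- The action of `Q ⊗[R] A` on `Q ⊗[R] M`. -/
noncomputable def baseChangeAction (Q : Type w) [CommRing Q] [Algebra R Q] (M : ModuleCat.{u} A) :
    Q ⊗[R] A →ₐ[R] Module.End R (Q ⊗[R] M) :=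
  (Module.endTensorEndAlgHom (R := R) (S := R) (A := R) (M := Q) (N := M)).comp
    (Algebra.TensorProduct.map (Algebra.lmul R Q) (Algebra.lsmul R R M))

theorem baseChangeAction_tmul (Q : Type w) [CommRing Q] [Algebra R Q] (M : ModuleCat.{u} A)
    (q q' : Q) (a : A) (m : M) :
    baseChangeAction Q M (q ⊗ₜ[R] a) (q' ⊗ₜ[R] m) = (q * q') ⊗ₜ[R] (a • m) := rfl

/-- The `Q ⊗[R] A`-module `Q ⊗[R] M`. -/
noncomputable def baseChange (Q : Type w) [CommRing Q] [Algebra R Q] (M : ModuleCat.{u} A) :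
    ModuleCat.{max w u} (Q ⊗[R] A) :=
  letI : Module (Q ⊗[R] A) (Q ⊗[R] M) := Module.compHom _ (baseChangeAction Q M).toRingHom
  ModuleCat.of (Q ⊗[R] A) (Q ⊗[R] M)

/-- The element `q ⊗ m` of `Q ⊗[R] M`. -/
def baseChangeMk {Q : Type w} [CommRing Q] [Algebra R Q] {M : ModuleCat.{u} A} (q : Q) (m : M) :
    baseChange (R := R) Q M :=
  (q ⊗ₜ[R] m : Q ⊗[R] M)

theorem smul_baseChangeMk {Q : Type w} [CommRing Q] [Algebra R Q] {M : ModuleCat.{u} A}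
    (q q' : Q) (a : A) (m : M) :
    (q ⊗ₜ[R] a) • baseChangeMk (R := R) q' m = baseChangeMk (q * q') (a • m) := rfl

end BaseChange

end SplitQH

/-! The proof is dévissage along projective presentations. Filtered modules are replaced by the
closure of `Δ` (or `∇`) under extensions and retracts. By condition 4 and a horseshoe argument,
every `M` in the closure of `Δ` has a presentation `0 → K → P → M → 0` with `P` finitely generated
projective and `K` again in the closure (`exists_presentation`). Since syzygies stay in the closure,
the vanishing of `Ext¹` suffices throughout.

Vanishing of `Ext¹` between the two closures makes Hom exact, so `Hom_A(M, N)` is finitely generated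
projective over `R`, being built from copies of `R` and `0` (`hom_finite_projective`). Hence `0 →
Hom(M, N) → Hom(P, N) → Hom(K, N) → 0` splits over `R`. Two natural maps are isomorphisms for `M =
P`, by a dual basis: the pairing `DN ⊗_A M → D Hom_A(M, N)` and the base change map on Hom. The
splitting and a five lemma argument carry both over to `M` (`dualPairing_bijective`,
`homBaseChange_bijective`).

The pairing gives the projectivity of `DN ⊗_A M` and the exactness of `DN ⊗_A -`. Splicing
presentations gives a projective resolution that stays exact in positive degrees after tensoring, so
Tor vanishes (`isZero_tor`). For `- ⊗_A M`, the exactness property of `DN ⊗_A -` is propagated from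
the modules `D∇(l)` to their closure (`isTensorAcyclic_of_closure`). -/

namespace SplitQH

/-! ### Closure under extensions and retracts; presentations with kernel in the closure -/

section Closure

variable {A : Type u} [Ring A]

/-- The smallest class of modules that contains all `Δ l` and the zero modules, and is closed under
extensions and retracts. -/
inductive ExtRetractClosure {Λ : Type v} (Δ : Λ → ModuleCat.{u} A) : ModuleCat.{u} A → Prop
  | base (l : Λ) : ExtRetractClosure Δ (Δ l)
  | zero (X : ModuleCat.{u} A) (h : Subsingleton X) : ExtRetractClosure Δ X
  | ext (X Y Z : ModuleCat.{u} A) (f : X →ₗ[A] Y) (g : Y →ₗ[A] Z) (hf : Function.Injective f)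
      (hfg : Function.Exact f g) (hg : Function.Surjective g) (hX : ExtRetractClosure Δ X)
      (hZ : ExtRetractClosure Δ Z) : ExtRetractClosure Δ Y
  | retract (X Y : ModuleCat.{u} A) (i : X →ₗ[A] Y) (p : Y →ₗ[A] X) (h : p ∘ₗ i = LinearMap.id)
      (hY : ExtRetractClosure Δ Y) : ExtRetractClosure Δ X

namespace ExtRetractClosure

variable {Λ : Type v} {Δ : Λ → ModuleCat.{u} A}

theorem of_linearEquiv {X Y : ModuleCat.{u} A} (e : X ≃ₗ[A] Y) (hY : ExtRetractClosure Δ Y) :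
    ExtRetractClosure Δ X :=
  retract X Y e e.symm (by ext; simp) hY

theorem prod {X Y : Type u} [AddCommGroup X] [Module A X] [AddCommGroup Y] [Module A Y]
    (hX : ExtRetractClosure Δ (ModuleCat.of A X)) (hY : ExtRetractClosure Δ (ModuleCat.of A Y)) :
    ExtRetractClosure Δ (ModuleCat.of A (X × Y)) :=
  ext (ModuleCat.of A X) (ModuleCat.of A (X × Y)) (ModuleCat.of A Y)
    (LinearMap.inl A X Y) (LinearMap.snd A X Y)
    LinearMap.inl_injective .inl_snd LinearMap.snd_surjective hX hY

theorem pi_fin (n : ℕ) {X : Fin n → Type u} [∀ i, AddCommGroup (X i)] [∀ i, Module A (X i)]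
    (hX : ∀ i, ExtRetractClosure Δ (ModuleCat.of A (X i))) :
    ExtRetractClosure Δ (ModuleCat.of A (∀ i, X i)) := by
  induction n with
  | zero => exact zero _ (inferInstanceAs (Subsingleton (∀ i : Fin 0, X i)))
  | succ n ih =>
    exact of_linearEquiv (Y := ModuleCat.of A (X 0 × ∀ i : Fin n, X i.succ))
      (Fin.consLinearEquiv A X).symm (prod (hX 0) (ih fun i => hX i.succ))

/-- The idempotent `1 - i ∘ p` projects `Y` onto the kernel, which is thus the complementary
retract. -/
theorem ker_of_retract {X Y : ModuleCat.{u} A} {i : X →ₗ[A] Y} {p : Y →ₗ[A] X}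
    (h : p ∘ₗ i = LinearMap.id) (hY : ExtRetractClosure Δ Y) :
    ExtRetractClosure Δ (ModuleCat.of A (LinearMap.ker p)) := by
  have h' : ∀ x, p (i x) = x := fun x => LinearMap.congr_fun h x
  refine retract (ModuleCat.of A (LinearMap.ker p)) Y (LinearMap.ker p).subtype
    ((LinearMap.id - i ∘ₗ p).codRestrict (LinearMap.ker p) fun y => by simp [h']) ?_ hY
  ext ⟨y, hy⟩
  have hy' : p y = 0 := hy
  simp [hy']

theorem of_hasFiltration {θ : ObjectProperty (ModuleCat.{u} A)}
    (hθ : ∀ X, θ X → ExtRetractClosure Δ X) {M : ModuleCat.{u} A} (hM : HasFiltration θ M) :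
    ExtRetractClosure Δ M := by
  obtain ⟨t, F, h0, ht, hF⟩ := hM
  -- The filtration decreases, so the induction climbs from its zero end `F t`; each step is an
  -- extension by one factor.
  have key : ∀ j ≤ t, ExtRetractClosure Δ (ModuleCat.of A (F (t - j))) := by
    intro j
    induction j with
    | zero =>
      intro _
      refine zero _ ?_
      rw [Nat.sub_zero, ht]
      exact inferInstanceAs (Subsingleton (⊥ : Submodule A M))
    | succ j ih =>
      intro hj
      obtain ⟨hle, hθi⟩ := hF (t - (j + 1)) (by omega)
      have hj' : t - (j + 1) + 1 = t - j := by omega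
      rw [hj'] at hle hθi
      refine ext (ModuleCat.of A (F (t - j))) _ (ModuleCat.of A _) (Submodule.inclusion hle)
        ((F (t - j)).submoduleOf (F (t - (j + 1)))).mkQ (Submodule.inclusion_injective hle) ?_
        (Submodule.mkQ_surjective _) (ih (by omega)) (hθ _ hθi)
      rw [LinearMap.exact_iff, Submodule.ker_mkQ, Submodule.range_inclusion]
      rfl
  have h := key t le_rfl
  rw [Nat.sub_self, h0] at h
  exact of_linearEquiv (Submodule.topEquiv (R := A) (M := M)).symm h

/-- `U` is a summand of some `Rⁿ`, so `Δ l ⊗ U` is a summand of `(Δ l)ⁿ`. -/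
theorem of_tildeOn {R : Type u} [CommRing R] [Algebra R A] {Γ : Set Λ} {X : ModuleCat.{u} A}
    (hX : tildeOn R Δ Γ X) : ExtRetractClosure Δ X := by
  obtain ⟨l, -, U, _, _, _, _, ⟨e⟩⟩ := hX
  obtain ⟨n, f, g, -, -, hfg⟩ := Module.Finite.exists_comp_eq_id_of_projective R U
  have hfg' : ∀ x, f (g x) = x := fun x => LinearMap.congr_fun hfg x
  let i : Δ l ⊗[R] U →ₗ[A] Fin n → Δ l := LinearMap.pi fun k =>
    (TensorProduct.AlgebraTensorModule.rid R A (Δ l)).toLinearMap ∘ₗ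
      TensorProduct.AlgebraTensorModule.lTensor A (Δ l) (LinearMap.proj k ∘ₗ g)
  let p : (Fin n → Δ l) →ₗ[A] Δ l ⊗[R] U := LinearMap.lsum A _ ℕ fun k =>
    TensorProduct.AlgebraTensorModule.lTensor A (Δ l) (f ∘ₗ LinearMap.single R _ k) ∘ₗ
      (TensorProduct.AlgebraTensorModule.rid R A (Δ l)).symm.toLinearMap
  have hip : ∀ z, p (i z) = z := by
    intro z
    induction z with
    | zero => rw [map_zero, map_zero]
    | add x y hx hy => rw [map_add, map_add, hx, hy]
    | tmul m u =>
      have h1 : p (i (m ⊗ₜ[R] u)) = ∑ k, (g u k • m) ⊗ₜ[R] f (Pi.single k 1) := by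
        simp [p, i, LinearMap.lsum_apply]
      simp_rw [h1, TensorProduct.smul_tmul, ← TensorProduct.tmul_sum, ← map_smul, ← map_sum]
      conv_rhs => rw [← hfg' u]
      congr 2
      ext j
      simp [Pi.single_apply]
  refine of_linearEquiv (Y := ModuleCat.of A (Δ l ⊗[R] U)) e ?_
  exact .retract (ModuleCat.of A (Δ l ⊗[R] U)) (ModuleCat.of A (Fin n → Δ l)) i p
    (LinearMap.ext hip) (.pi_fin n fun _ => base (Δ := Δ) l)

theorem of_filt {R : Type u} [CommRing R] [Algebra R A] {M : ModuleCat.{u} A}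
    (hM : Filt R Δ M) : ExtRetractClosure Δ M :=
  of_hasFiltration (fun _ => of_tildeOn) hM

/-- Every member of the closure has a presentation by a finitely generated projective module, with
kernel in the closure, as soon as all `Δ l` have one. -/
theorem exists_presentation
    (hΔ : ∀ l, ∃ (P : ModuleCat.{u} A) (π : P →ₗ[A] Δ l), Module.Finite A P ∧
      Module.Projective A P ∧ Function.Surjective π ∧
      ExtRetractClosure Δ (ModuleCat.of A (LinearMap.ker π)))
    {M : ModuleCat.{u} A} (hM : ExtRetractClosure Δ M) :
    ∃ (P : ModuleCat.{u} A) (π : P →ₗ[A] M), Module.Finite A P ∧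
      Module.Projective A P ∧ Function.Surjective π ∧
      ExtRetractClosure Δ (ModuleCat.of A (LinearMap.ker π)) := by
  induction hM with
  | base l => exact hΔ l
  | zero X h =>
    exact ⟨X, LinearMap.id, inferInstance, .of_free, Function.surjective_id,
      zero _ (inferInstanceAs (Subsingleton (LinearMap.ker (LinearMap.id : X →ₗ[A] X))))⟩
  -- Horseshoe lemma: `σ` lifts `π'` through `g`, and `P × P'` covers `Y`, with kernel an extension
  -- of `ker π'` by `ker π`.
  | ext X Y Z f g hf hfg hg hX hZ ihX ihZ =>
    obtain ⟨P, π, _, _, hπ, hK⟩ := ihX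
    obtain ⟨P', π', _, _, hπ', hK'⟩ := ihZ
    obtain ⟨σ, hσ⟩ := Module.projective_lifting_property g π' hg
    have hσ' : ∀ b, g (σ b) = π' b := fun b => LinearMap.congr_fun hσ b
    have hgf : ∀ x, g (f x) = 0 := hfg.apply_apply_eq_zero
    have hgt : ∀ c : P × P', g ((f ∘ₗ π).coprod σ c) = π' c.2 := fun c => by
      simp [hgf, hσ']
    refine ⟨ModuleCat.of A (P × P'), (f ∘ₗ π).coprod σ, inferInstanceAs (Module.Finite A (P × P')),
      inferInstanceAs (Module.Projective A (P × P')), ?_, ?_⟩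
    · intro y
      obtain ⟨b, hb⟩ := hπ' (g y)
      obtain ⟨x, hx⟩ := (hfg (y - σ b)).1 (by rw [map_sub, hσ', hb, sub_self])
      obtain ⟨a, rfl⟩ := hπ x
      exact ⟨(a, b), by simp [hx]⟩
    · refine ext (ModuleCat.of A (LinearMap.ker π)) _ (ModuleCat.of A (LinearMap.ker π'))
        (((LinearMap.inl A P P').comp (LinearMap.ker π).subtype).codRestrict
          (LinearMap.ker ((f ∘ₗ π).coprod σ)) ?_)
        (((LinearMap.snd A P P').comp (LinearMap.ker ((f ∘ₗ π).coprod σ)).subtype).codRestrict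
          (LinearMap.ker π') ?_) ?_ ?_ ?_ hK hK'
      · rintro ⟨a, ha⟩
        have ha' : π a = 0 := ha
        simp [ha']
      · rintro ⟨c, hc⟩
        have hc' : (f ∘ₗ π).coprod σ c = 0 := hc
        have := hgt c
        rw [hc', map_zero] at this
        exact this.symm
      · rintro ⟨a, ha⟩ ⟨b, hb⟩ hab
        have := congrArg (fun z => (Subtype.val z).1) hab
        exact Subtype.ext this
      · rintro ⟨⟨a, b⟩, hc⟩
        constructor
        · intro h
          have hb : b = 0 := congrArg Subtype.val h
          subst hb
          refine ⟨⟨a, ?_⟩, rfl⟩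
          have hc' : (f ∘ₗ π).coprod σ (a, 0) = 0 := hc
          apply hf
          simpa using hc'
        · rintro ⟨a', ha'⟩
          have : (0 : P') = b := congrArg (fun z => (Subtype.val z).2) ha'
          exact Subtype.ext this.symm
      · rintro ⟨b, hb⟩
        have hb' : π' b = 0 := hb
        obtain ⟨x, hx⟩ := (hfg (σ b)).1 (by rw [hσ', hb'])
        obtain ⟨a, rfl⟩ := hπ x
        -- The sign cancels `σ b = f (π a)`.
        exact ⟨⟨(-a, b), by simp [hx]⟩, rfl⟩
  -- A cover of `Y` also covers `X`; its new kernel is an extension of `ker p` by `ker π`, and `ker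
  -- p` is a retract of `Y`.
  | retract X Y i p h hY ih =>
    obtain ⟨P, π, hP, hP', hπ, hK⟩ := ih
    have hpi : Function.Surjective p := fun x => ⟨i x, LinearMap.congr_fun h x⟩
    refine ⟨P, p ∘ₗ π, hP, hP', hpi.comp hπ, ?_⟩
    refine ext (ModuleCat.of A (LinearMap.ker π)) _ (ModuleCat.of A (LinearMap.ker p))
      (Submodule.inclusion (LinearMap.ker_le_ker_comp π p))
      (π.restrict (p := LinearMap.ker (p ∘ₗ π)) (q := LinearMap.ker p) fun x hx => hx)
      (Submodule.inclusion_injective _) ?_ ?_ hK (ker_of_retract h hY)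
    · rintro ⟨x, hx⟩
      constructor
      · intro h0
        exact ⟨⟨x, congrArg Subtype.val h0⟩, rfl⟩
      · rintro ⟨⟨y, hy⟩, hyx⟩
        have : y = x := congrArg Subtype.val hyx
        subst this
        exact Subtype.ext hy
    · rintro ⟨y, hy⟩
      obtain ⟨x, rfl⟩ := hπ y
      exact ⟨⟨x, hy⟩, rfl⟩

end ExtRetractClosure

end Closure

namespace IsSplitQuasiHereditary

variable {R A : Type u} [CommRing R] [Ring A] [Algebra R A] {Λ : Type v} [PartialOrder Λ]
  {Δ : Λ → ModuleCat.{u} A}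

theorem exists_presentation (hΔ : IsSplitQuasiHereditary R A Δ) {M : ModuleCat.{u} A}
    (hM : ExtRetractClosure Δ M) :
    ∃ (P : ModuleCat.{u} A) (π : P →ₗ[A] M), Module.Finite A P ∧
      Module.Projective A P ∧ Function.Surjective π ∧
      ExtRetractClosure Δ (ModuleCat.of A (LinearMap.ker π)) := by
  obtain ⟨P, hP, -⟩ := hΔ.exists_projectives
  refine hM.exists_presentation fun l => ?_
  obtain ⟨hf, hp, π, hπ, hK⟩ := hP l
  exact ⟨P l, π, hf, hp, hπ, .of_hasFiltration (fun _ => .of_tildeOn) hK⟩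

end IsSplitQuasiHereditary

/-! ### Short exact sequences: splitting, and lifting problems controlled by `Ext¹` -/

section ShortExact

/-- `0 → X → Y → Z → 0` is exact. -/
structure IsShortExact {S X Y Z : Type*} [Ring S] [AddCommGroup X] [AddCommGroup Y]
    [AddCommGroup Z] [Module S X] [Module S Y] [Module S Z] (f : X →ₗ[S] Y) (g : Y →ₗ[S] Z) :
    Prop where
  injective : Function.Injective f
  exact : Function.Exact f g
  surjective : Function.Surjective g

theorem isShortExact_ker {S Y Z : Type*} [Ring S] [AddCommGroup Y] [AddCommGroup Z] [Module S Y]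
    [Module S Z] {g : Y →ₗ[S] Z} (hg : Function.Surjective g) :
    IsShortExact (LinearMap.ker g).subtype g :=
  ⟨Subtype.val_injective, g.exact_subtype_ker_map, hg⟩

namespace IsShortExact

section

variable {S X Y Z : Type*} [Ring S] [AddCommGroup X] [AddCommGroup Y] [AddCommGroup Z]
  [Module S X] [Module S Y] [Module S Z] {f : X →ₗ[S] Y} {g : Y →ₗ[S] Z}

theorem comp_eq_zero (h : IsShortExact f g) : g ∘ₗ f = 0 :=
  LinearMap.ext h.exact.apply_apply_eq_zero

/-- A section of `g` exists because the quotient is projective, and it identifies `Y` with `X × Z`.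
-/
theorem finite_projective (h : IsShortExact f g)
    (hX : Module.Finite S X ∧ Module.Projective S X)
    (hZ : Module.Finite S Z ∧ Module.Projective S Z) :
    Module.Finite S Y ∧ Module.Projective S Y := by
  obtain ⟨_, _⟩ := hX
  obtain ⟨_, _⟩ := hZ
  obtain ⟨σ, hσ⟩ := Module.projective_lifting_property g LinearMap.id h.surjective
  have hσ' : ∀ z, g (σ z) = z := fun z => LinearMap.congr_fun hσ z
  have hgf := h.exact.apply_apply_eq_zero
  let e : (X × Z) ≃ₗ[S] Y := LinearEquiv.ofBijective (f.coprod σ) <| by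
    constructor
    · refine (injective_iff_map_eq_zero _).2 ?_
      rintro ⟨x, z⟩ hxz
      have hxz' : f x + σ z = 0 := by simpa using hxz
      have hz : z = 0 := by
        have := congrArg g hxz'
        simpa [hgf, hσ'] using this
      subst hz
      have hx : x = 0 := h.injective (by simpa using hxz')
      rw [hx]
      rfl
    · intro y
      obtain ⟨x, hx⟩ := (h.exact (y - σ (g y))).1 (by simp [hσ'])
      exact ⟨(x, g y), by simp [hx]⟩
  exact ⟨Module.Finite.equiv e, Module.Projective.of_equiv e⟩

/-- A map vanishing on the image of `f` descends along `g`. -/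
theorem exists_desc (h : IsShortExact f g) {W : Type*} [AddCommGroup W] [Module S W]
    (d : Y →ₗ[S] W) (hd : d ∘ₗ f = 0) : ∃ e : Z →ₗ[S] W, e ∘ₗ g = d := by
  have hle : LinearMap.ker g ≤ LinearMap.ker d := by
    intro y hy
    obtain ⟨x, rfl⟩ := (h.exact y).1 hy
    exact LinearMap.congr_fun hd x
  refine ⟨(LinearMap.ker g).liftQ d hle ∘ₗ
    (g.quotKerEquivOfSurjective h.surjective).symm.toLinearMap, ?_⟩
  ext y
  change (LinearMap.ker g).liftQ d hle ((g.quotKerEquivOfSurjective h.surjective).symm (g y))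
    = d y
  have : (g.quotKerEquivOfSurjective h.surjective).symm (g y) = (LinearMap.ker g).mkQ y := by
    rw [LinearEquiv.symm_apply_eq]
    rfl
  rw [this]
  rfl

/-- If the third term is projective, the sequence splits. -/
theorem exists_retraction (h : IsShortExact f g) [Module.Projective S Z] :
    ∃ r : Y →ₗ[S] X, r ∘ₗ f = LinearMap.id := by
  obtain ⟨σ, hσ⟩ := Module.projective_lifting_property g LinearMap.id h.surjective
  have hσ' : ∀ z, g (σ z) = z := fun z => LinearMap.congr_fun hσ z
  refine ⟨(LinearEquiv.ofInjective f h.injective).symm.toLinearMap ∘ₗ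
    (LinearMap.id - σ ∘ₗ g).codRestrict (LinearMap.range f) fun y =>
      (h.exact _).1 (by simp [hσ']), ?_⟩
  ext x
  refine ((LinearEquiv.ofInjective f h.injective).symm_apply_eq).2 ?_
  apply Subtype.ext
  change f x - σ (g (f x)) = f x
  rw [h.exact.apply_apply_eq_zero, map_zero, sub_zero]

end

section

variable {A : Type u} [Ring A] {X Y Z : ModuleCat.{u} A} {f : X →ₗ[A] Y} {g : Y →ₗ[A] Z}

theorem shortExact (h : IsShortExact f g) :
    (ShortComplex.mk (ModuleCat.ofHom f) (ModuleCat.ofHom g)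
      (ModuleCat.hom_ext h.comp_eq_zero)).ShortExact :=
  ModuleCat.shortComplex_shortExact _ h.exact h.injective h.surjective

/-- The obstruction to extending `k` is its image under the connecting map into `Ext¹(Z, N)`. -/
theorem exists_extend (h : IsShortExact f g) {N : ModuleCat.{u} A}
    (hN : Subsingleton (Abelian.Ext Z N 1)) (k : X →ₗ[A] N) : ∃ k' : Y →ₗ[A] N, k' ∘ₗ f = k := by
  obtain ⟨x, hx⟩ := Abelian.Ext.contravariant_sequence_exact₁ h.shortExact N
    (Abelian.Ext.mk₀ (ModuleCat.ofHom k)) rfl (hN.elim _ _)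
  obtain ⟨k', rfl⟩ := Abelian.Ext.addEquiv₀.symm.surjective x
  rw [Abelian.Ext.addEquiv₀_symm_apply, Abelian.Ext.mk₀_comp_mk₀] at hx
  have := (Abelian.Ext.mk₀_bijective _ _).injective hx
  exact ⟨k'.hom, congrArg ModuleCat.Hom.hom this⟩

theorem exists_lift (h : IsShortExact f g) {M : ModuleCat.{u} A}
    (hM : Subsingleton (Abelian.Ext M X 1)) (k : M →ₗ[A] Z) : ∃ k' : M →ₗ[A] Y, g ∘ₗ k' = k := by
  obtain ⟨x, hx⟩ := Abelian.Ext.covariant_sequence_exact₃ M h.shortExact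
    (Abelian.Ext.mk₀ (ModuleCat.ofHom k)) rfl (hM.elim _ _)
  obtain ⟨k', rfl⟩ := Abelian.Ext.addEquiv₀.symm.surjective x
  rw [Abelian.Ext.addEquiv₀_symm_apply, Abelian.Ext.mk₀_comp_mk₀] at hx
  have := (Abelian.Ext.mk₀_bijective _ _).injective hx
  exact ⟨k'.hom, congrArg ModuleCat.Hom.hom this⟩

end

end IsShortExact

end ShortExact

/-! ### Vanishing of `Ext¹` on the closures, and projectivity of Hom over `R` -/

section Hom

variable {A : Type u} [Ring A]

/-- In an extension, `Ext¹` of the middle term lies between two vanishing groups; for a retract, a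
class factors through `Ext¹` of the larger module. -/
theorem ext_one_subsingleton_left {Λ : Type v} {Δ : Λ → ModuleCat.{u} A} {N : ModuleCat.{u} A}
    (hΔ : ∀ l, Subsingleton (Abelian.Ext (Δ l) N 1)) {M : ModuleCat.{u} A}
    (hM : ExtRetractClosure Δ M) : Subsingleton (Abelian.Ext M N 1) := by
  induction hM with
  | base l => exact hΔ l
  | zero X h =>
    refine subsingleton_of_forall_eq 0 fun x => ?_
    have h0 : 𝟙 X = 0 := ModuleCat.hom_ext (LinearMap.ext fun a => h.elim _ _)
    rw [← Abelian.Ext.mk₀_id_comp x, h0, Abelian.Ext.mk₀_zero, Abelian.Ext.zero_comp]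
  | ext X Y Z f g hf hfg hg hX hZ ihX ihZ =>
    refine subsingleton_of_forall_eq 0 fun x => ?_
    have h : IsShortExact f g := ⟨hf, hfg, hg⟩
    obtain ⟨y, rfl⟩ := Abelian.Ext.contravariant_sequence_exact₂ h.shortExact N x (ihX.elim _ _)
    rw [ihZ.elim y 0, Abelian.Ext.comp_zero]
  | retract X Y i p h hY ih =>
    refine subsingleton_of_forall_eq 0 fun x => ?_
    have h0 : ModuleCat.ofHom i ≫ ModuleCat.ofHom p = 𝟙 X := ModuleCat.hom_ext h
    rw [← Abelian.Ext.mk₀_id_comp x, ← h0, ← Abelian.Ext.mk₀_comp_mk₀_assoc,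
      ih.elim ((Abelian.Ext.mk₀ (ModuleCat.ofHom p)).comp x (zero_add 1)) 0,
      Abelian.Ext.comp_zero]

theorem ext_one_subsingleton_right {Λ : Type v} {nabla : Λ → ModuleCat.{u} A}
    {M : ModuleCat.{u} A} (hnabla : ∀ l, Subsingleton (Abelian.Ext M (nabla l) 1))
    {N : ModuleCat.{u} A} (hN : ExtRetractClosure nabla N) :
    Subsingleton (Abelian.Ext M N 1) := by
  induction hN with
  | base l => exact hnabla l
  | zero X h =>
    refine subsingleton_of_forall_eq 0 fun x => ?_
    have h0 : 𝟙 X = 0 := ModuleCat.hom_ext (LinearMap.ext fun a => h.elim _ _)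
    rw [← Abelian.Ext.comp_mk₀_id x, h0, Abelian.Ext.mk₀_zero, Abelian.Ext.comp_zero]
  | ext X Y Z f g hf hfg hg hX hZ ihX ihZ =>
    refine subsingleton_of_forall_eq 0 fun x => ?_
    have h : IsShortExact f g := ⟨hf, hfg, hg⟩
    obtain ⟨y, rfl⟩ := Abelian.Ext.covariant_sequence_exact₂ M h.shortExact x (ihZ.elim _ _)
    rw [ihX.elim y 0, Abelian.Ext.zero_comp]
  | retract X Y i p h hY ih =>
    refine subsingleton_of_forall_eq 0 fun x => ?_
    have h0 : ModuleCat.ofHom i ≫ ModuleCat.ofHom p = 𝟙 X := ModuleCat.hom_ext h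
    rw [← Abelian.Ext.comp_mk₀_id x, ← h0, ← Abelian.Ext.mk₀_comp_mk₀,
      ← Abelian.Ext.comp_assoc_of_third_deg_zero,
      ih.elim (x.comp (Abelian.Ext.mk₀ (ModuleCat.ofHom i)) (add_zero 1)) 0,
      Abelian.Ext.zero_comp]

variable (R : Type u) [CommRing R] [Algebra R A]

/-- Precomposition with `f`, as an `R`-linear map. -/
def precomp {X Y : ModuleCat.{u} A} (f : X →ₗ[A] Y) (N : ModuleCat.{u} A) :
    (Y →ₗ[A] N) →ₗ[R] (X →ₗ[A] N) where
  toFun k := k ∘ₗ f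
  map_add' _ _ := rfl
  map_smul' _ _ := rfl

/-- Postcomposition with `f`, as an `R`-linear map. -/
def postcomp {X Y : ModuleCat.{u} A} (M : ModuleCat.{u} A) (f : X →ₗ[A] Y) :
    (M →ₗ[A] X) →ₗ[R] (M →ₗ[A] Y) where
  toFun k := f ∘ₗ k
  map_add' _ _ := LinearMap.comp_add _ _ _
  map_smul' r k := LinearMap.ext fun m => (f.restrictScalars R).map_smul r (k m)

theorem IsShortExact.precomp {X Y Z : ModuleCat.{u} A} {f : X →ₗ[A] Y} {g : Y →ₗ[A] Z}
    (h : IsShortExact f g) {N : ModuleCat.{u} A} (hN : Subsingleton (Abelian.Ext Z N 1)) :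
    IsShortExact (precomp R g N) (precomp R f N) where
  injective k k' hk := LinearMap.ext fun z => by
    obtain ⟨y, rfl⟩ := h.surjective z
    exact LinearMap.congr_fun hk y
  exact := by
    intro k
    constructor
    · exact h.exists_desc k
    · rintro ⟨k', rfl⟩
      change (k' ∘ₗ g) ∘ₗ f = 0
      rw [LinearMap.comp_assoc, h.comp_eq_zero, LinearMap.comp_zero]
  surjective := h.exists_extend hN

theorem IsShortExact.postcomp {X Y Z : ModuleCat.{u} A} {f : X →ₗ[A] Y} {g : Y →ₗ[A] Z}
    (h : IsShortExact f g) {M : ModuleCat.{u} A} (hM : Subsingleton (Abelian.Ext M X 1)) :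
    IsShortExact (postcomp R M f) (postcomp R M g) where
  injective k k' hk := LinearMap.ext fun m => h.injective (LinearMap.congr_fun hk m)
  exact := by
    intro k
    constructor
    · intro hk
      have hk' : ∀ m, ∃ x, f x = k m := fun m => (h.exact (k m)).1 (LinearMap.congr_fun hk m)
      have hr : ∀ m, k m ∈ LinearMap.range f := hk'
      refine ⟨(LinearEquiv.ofInjective f h.injective).symm.toLinearMap ∘ₗ
        k.codRestrict (LinearMap.range f) hr, ?_⟩
      ext m
      exact congrArg Subtype.val
        ((LinearEquiv.ofInjective f h.injective).apply_symm_apply ⟨k m, hr m⟩)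
    · rintro ⟨k', rfl⟩
      change g ∘ₗ (f ∘ₗ k') = 0
      rw [← LinearMap.comp_assoc, h.comp_eq_zero, LinearMap.zero_comp]
  surjective := h.exists_lift hM

theorem finite_projective_of_subsingleton (X : Type*) [AddCommGroup X] [Module R X]
    [Subsingleton X] : Module.Finite R X ∧ Module.Projective R X :=
  ⟨inferInstance, .of_free⟩

theorem finite_projective_of_retract {X Y : Type*} [AddCommGroup X] [Module R X] [AddCommGroup Y]
    [Module R Y] {i : X →ₗ[R] Y} {p : Y →ₗ[R] X} (h : p ∘ₗ i = LinearMap.id)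
    (hY : Module.Finite R Y ∧ Module.Projective R Y) :
    Module.Finite R X ∧ Module.Projective R X := by
  obtain ⟨_, _⟩ := hY
  exact ⟨.of_surjective p fun x => ⟨i x, LinearMap.congr_fun h x⟩, .of_split i p h⟩

end Hom

namespace IsCostandard

variable {R A : Type u} [CommRing R] [Ring A] [Algebra R A] {Λ : Type v} [PartialOrder Λ]
  {Δ nabla : Λ → ModuleCat.{u} A}

theorem ext_one (hnabla : IsCostandard R A Δ nabla) {M N : ModuleCat.{u} A}
    (hM : ExtRetractClosure Δ M) (hN : ExtRetractClosure nabla N) :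
    Subsingleton (Abelian.Ext M N 1) :=
  ext_one_subsingleton_left (fun l =>
    ext_one_subsingleton_right (fun m => hnabla.ext_vanish l m 1 one_pos) hN) hM

/-- Dévissage in `N` with the standard module fixed: the base values are `R` and `0`, and `Ext¹`
vanishing keeps Hom exact. Dévissage in `M` comes afterwards. -/
theorem hom_finite_projective_base (hnabla : IsCostandard R A Δ nabla) (l : Λ)
    {N : ModuleCat.{u} A} (hN : ExtRetractClosure nabla N) :
    Module.Finite R (Δ l →ₗ[A] N) ∧ Module.Projective R (Δ l →ₗ[A] N) := by
  induction hN with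
  | base m =>
    by_cases h : l = m
    · subst h
      obtain ⟨e⟩ := hnabla.hom_self l
      exact ⟨.equiv e.symm, .of_equiv e.symm⟩
    · have := hnabla.hom_of_ne l m h
      exact finite_projective_of_subsingleton R _
  | zero X h =>
    have : Subsingleton (Δ l →ₗ[A] X) := ⟨fun f g => LinearMap.ext fun _ => h.elim _ _⟩
    exact finite_projective_of_subsingleton R _
  | ext X Y Z f g hf hfg hg hX hZ ihX ihZ =>
    have h : IsShortExact f g := ⟨hf, hfg, hg⟩
    exact (h.postcomp R (hnabla.ext_one (.base l) hX)).finite_projective ihX ihZ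
  | retract X Y i p h hY ih =>
    refine finite_projective_of_retract R (i := postcomp R _ i) (p := postcomp R _ p) ?_ ih
    ext k : 1
    change p ∘ₗ (i ∘ₗ k) = k
    rw [← LinearMap.comp_assoc, h, LinearMap.id_comp]

theorem hom_finite_projective (hnabla : IsCostandard R A Δ nabla) {M N : ModuleCat.{u} A}
    (hM : ExtRetractClosure Δ M) (hN : ExtRetractClosure nabla N) :
    Module.Finite R (M →ₗ[A] N) ∧ Module.Projective R (M →ₗ[A] N) := by
  induction hM with
  | base l => exact hnabla.hom_finite_projective_base l hN
  | zero X h =>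
    have : Subsingleton (X →ₗ[A] N) :=
      ⟨fun f g => LinearMap.ext fun x => by rw [h.elim x 0, map_zero, map_zero]⟩
    exact finite_projective_of_subsingleton R _
  | ext X Y Z f g hf hfg hg hX hZ ihX ihZ =>
    have h : IsShortExact f g := ⟨hf, hfg, hg⟩
    exact (h.precomp R (hnabla.ext_one hZ hN)).finite_projective ihZ ihX
  | retract X Y i p h hY ih =>
    refine finite_projective_of_retract R (i := precomp R p N) (p := precomp R i N) ?_ ih
    ext k : 1
    change (k ∘ₗ p) ∘ₗ i = k
    rw [LinearMap.comp_assoc, h, LinearMap.comp_id]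

end IsCostandard

/-! ### Tensor products over `A`: induction, functoriality, right exactness -/

section Tensor

variable (R : Type u) {A : Type u} [CommRing R] [Ring A] [Algebra R A]

theorem tensorMk_smul {X : ModuleCat.{u} Aᵐᵒᵖ} {Y : ModuleCat.{u} A} (x : X) (a : A) (y : Y) :
    tensorMk R (op a • x) y = tensorMk R x (a • y) :=
  (Submodule.Quotient.eq _).2 (Submodule.subset_span ⟨x, a, y, rfl⟩)

theorem tensorMk_sum_right {X : ModuleCat.{u} Aᵐᵒᵖ} {Y : ModuleCat.{u} A} (x : X) {ι : Type*}
    (s : Finset ι) (y : ι → Y) : tensorMk R x (∑ i ∈ s, y i) = ∑ i ∈ s, tensorMk R x (y i) :=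
  map_sum (AddMonoidHom.mk' (tensorMk R x) (tensorMk_add_right R x)) _ _

variable {R}

theorem tensorOver_induction {X : ModuleCat.{u} Aᵐᵒᵖ} {Y : ModuleCat.{u} A}
    {motive : tensorOver R X Y → Prop} (zero : motive 0)
    (mk : ∀ x y, motive (tensorMk R x y)) (add : ∀ z z', motive z → motive z' → motive (z + z'))
    (z : tensorOver R X Y) : motive z := by
  obtain ⟨z, rfl⟩ := Submodule.mkQ_surjective (balanced R X Y) z
  induction z with
  | zero => rw [map_zero]; exact zero
  | tmul x y => exact mk x y
  | add z z' hz hz' => rw [map_add]; exact add _ _ hz hz'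

/-- The map out of `X ⊗_A Y` given by a balanced bilinear map. -/
def tensorLift {X : ModuleCat.{u} Aᵐᵒᵖ} {Y : ModuleCat.{u} A} {Z : Type*} [AddCommGroup Z]
    [Module R Z] (b : X →ₗ[R] Y →ₗ[R] Z) (hb : ∀ (x : X) (a : A) (y : Y), b (op a • x) y = b x (a • y)) :
    tensorOver R X Y →ₗ[R] Z :=
  (balanced R X Y).liftQ (TensorProduct.lift b) <| Submodule.span_le.2 <| by
    rintro _ ⟨x, a, y, rfl⟩
    simp [hb]

theorem tensorMap_comp_apply {X X' X'' : ModuleCat.{u} Aᵐᵒᵖ} {Y Y' Y'' : ModuleCat.{u} A}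
    (f : X →ₗ[Aᵐᵒᵖ] X') (f' : X' →ₗ[Aᵐᵒᵖ] X'') (g : Y →ₗ[A] Y') (g' : Y' →ₗ[A] Y'')
    (z : tensorOver R X Y) :
    (tensorMap R f' g').hom ((tensorMap R f g).hom z)
      = (tensorMap R (f' ∘ₗ f) (g' ∘ₗ g)).hom z := by
  induction z using tensorOver_induction with
  | zero => simp
  | mk x y => rfl
  | add z z' hz hz' => simp only [map_add, hz, hz']

theorem tensorMap_id_apply {X : ModuleCat.{u} Aᵐᵒᵖ} {Y : ModuleCat.{u} A}
    (z : tensorOver R X Y) :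
    (tensorMap R (LinearMap.id : X →ₗ[Aᵐᵒᵖ] X) (LinearMap.id : Y →ₗ[A] Y)).hom z = z := by
  induction z using tensorOver_induction with
  | zero => simp
  | mk x y => rfl
  | add z z' hz hz' => simp only [map_add, hz, hz']

theorem tensorMap_zero_left_apply {X X' : ModuleCat.{u} Aᵐᵒᵖ} {Y Y' : ModuleCat.{u} A}
    (g : Y →ₗ[A] Y') (z : tensorOver R X Y) :
    (tensorMap R (0 : X →ₗ[Aᵐᵒᵖ] X') g).hom z = 0 := by
  induction z using tensorOver_induction with
  | zero => simp
  | mk x y => exact congrArg (Submodule.mkQ _) (TensorProduct.zero_tmul _ _)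
  | add z z' hz hz' => simp only [map_add, hz, hz', add_zero]

theorem tensorMap_zero_right_apply {X X' : ModuleCat.{u} Aᵐᵒᵖ} {Y Y' : ModuleCat.{u} A}
    (f : X →ₗ[Aᵐᵒᵖ] X') (z : tensorOver R X Y) :
    (tensorMap R f (0 : Y →ₗ[A] Y')).hom z = 0 := by
  induction z using tensorOver_induction with
  | zero => simp
  | mk x y => exact congrArg (Submodule.mkQ _) (TensorProduct.tmul_zero _ _)
  | add z z' hz hz' => simp only [map_add, hz, hz', add_zero]

theorem tensorMap_surjective {X X' : ModuleCat.{u} Aᵐᵒᵖ} {Y Y' : ModuleCat.{u} A}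
    {f : X →ₗ[Aᵐᵒᵖ] X'} {g : Y →ₗ[A] Y'} (hf : Function.Surjective f)
    (hg : Function.Surjective g) : Function.Surjective (tensorMap R f g).hom := by
  intro z
  induction z using tensorOver_induction with
  | zero => exact ⟨0, map_zero _⟩
  | mk x y =>
    obtain ⟨x, rfl⟩ := hf x
    obtain ⟨y, rfl⟩ := hg y
    exact ⟨tensorMk R x y, rfl⟩
  | add z z' hz hz' =>
    obtain ⟨z, rfl⟩ := hz
    obtain ⟨z', rfl⟩ := hz'
    exact ⟨z + z', map_add _ _ _⟩

/-- Balancing relations lift along surjections. This reduces right exactness over `A` to right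
exactness over `R`. -/
theorem balanced_le_map {X X' : ModuleCat.{u} Aᵐᵒᵖ} {Y Y' : ModuleCat.{u} A}
    {f : X →ₗ[Aᵐᵒᵖ] X'} {g : Y →ₗ[A] Y'} (hf : Function.Surjective f)
    (hg : Function.Surjective g) :
    balanced R X' Y' ≤ (balanced R X Y).map
      (TensorProduct.map (f.restrictScalars R) (g.restrictScalars R)) := by
  refine Submodule.span_le.2 ?_
  rintro _ ⟨x, a, y, rfl⟩
  obtain ⟨x, rfl⟩ := hf x
  obtain ⟨y, rfl⟩ := hg y
  exact ⟨_, Submodule.subset_span ⟨x, a, y, rfl⟩, by simp⟩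

/-- Right exactness of the tensor product in the second variable. -/
theorem tensorMap_exact_right (X : ModuleCat.{u} Aᵐᵒᵖ) {Y Y' Y'' : ModuleCat.{u} A}
    {f : Y →ₗ[A] Y'} {g : Y' →ₗ[A] Y''} (h : Function.Exact f g) (hg : Function.Surjective g) :
    Function.Exact (tensorMap R (LinearMap.id : X →ₗ[Aᵐᵒᵖ] X) f).hom
      (tensorMap R (LinearMap.id : X →ₗ[Aᵐᵒᵖ] X) g).hom := by
  intro z
  constructor
  · obtain ⟨z, rfl⟩ := Submodule.mkQ_surjective (balanced R X Y') z
    intro hz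
    have hz' : TensorProduct.map (LinearMap.id.restrictScalars R) (g.restrictScalars R) z ∈
        balanced R X Y'' := (Submodule.Quotient.mk_eq_zero _).1 hz
    -- Subtracting a relation `b` leaves the class of `z` unchanged and makes `z - b` vanish already
    -- in the tensor product over `R`.
    obtain ⟨b, hb, hbz⟩ := balanced_le_map (R := R) (f := (LinearMap.id : X →ₗ[Aᵐᵒᵖ] X))
      Function.surjective_id hg hz'
    have h0 : (g.restrictScalars R).lTensor X (z - b) = 0 := by
      rw [map_sub, sub_eq_zero]
      exact hbz.symm
    obtain ⟨y, hy⟩ := (lTensor_exact X (f := f.restrictScalars R) (g := g.restrictScalars R)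
      h hg (z - b)).1 h0
    refine ⟨(balanced R X Y).mkQ y, ?_⟩
    change (balanced R X Y').mkQ ((f.restrictScalars R).lTensor X y) = (balanced R X Y').mkQ z
    rw [hy, map_sub, sub_eq_self]
    exact (Submodule.Quotient.mk_eq_zero _).2 hb
  · rintro ⟨y, rfl⟩
    rw [tensorMap_comp_apply, LinearMap.ext h.apply_apply_eq_zero (g := 0) (f := g ∘ₗ f)]
    exact tensorMap_zero_right_apply _ _

/-- Right exactness of the tensor product in the first variable. -/
theorem tensorMap_exact_left {X X' X'' : ModuleCat.{u} Aᵐᵒᵖ} (Y : ModuleCat.{u} A)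
    {f : X →ₗ[Aᵐᵒᵖ] X'} {g : X' →ₗ[Aᵐᵒᵖ] X''} (h : Function.Exact f g)
    (hg : Function.Surjective g) :
    Function.Exact (tensorMap R f (LinearMap.id : Y →ₗ[A] Y)).hom
      (tensorMap R g (LinearMap.id : Y →ₗ[A] Y)).hom := by
  intro z
  constructor
  · obtain ⟨z, rfl⟩ := Submodule.mkQ_surjective (balanced R X' Y) z
    intro hz
    have hz' : TensorProduct.map (g.restrictScalars R) (LinearMap.id.restrictScalars R) z ∈
        balanced R X'' Y := (Submodule.Quotient.mk_eq_zero _).1 hz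
    obtain ⟨b, hb, hbz⟩ := balanced_le_map (R := R) (g := (LinearMap.id : Y →ₗ[A] Y))
      hg Function.surjective_id hz'
    have h0 : (g.restrictScalars R).rTensor Y (z - b) = 0 := by
      rw [map_sub, sub_eq_zero]
      exact hbz.symm
    obtain ⟨y, hy⟩ := (rTensor_exact Y (f := f.restrictScalars R) (g := g.restrictScalars R)
      h hg (z - b)).1 h0
    refine ⟨(balanced R X Y).mkQ y, ?_⟩
    change (balanced R X' Y).mkQ ((f.restrictScalars R).rTensor Y y) = (balanced R X' Y).mkQ z
    rw [hy, map_sub, sub_eq_self]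
    exact (Submodule.Quotient.mk_eq_zero _).2 hb
  · rintro ⟨y, rfl⟩
    rw [tensorMap_comp_apply, LinearMap.ext h.apply_apply_eq_zero (g := 0) (f := g ∘ₗ f)]
    exact tensorMap_zero_left_apply _ _

end Tensor

/-! ### Dual bases of finitely generated projective modules -/

section DualBasis

variable (R : Type u) {A : Type u} [CommRing R] [Ring A] [Algebra R A]

theorem exists_dualBasis (P : ModuleCat.{u} A) [Module.Finite A P] [Module.Projective A P] :
    ∃ (n : ℕ) (p : Fin n → P) (c : Fin n → P →ₗ[A] A), ∀ x, ∑ i, c i x • p i = x := by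
  obtain ⟨n, f, g, -, -, hfg⟩ := Module.Finite.exists_comp_eq_id_of_projective A P
  refine ⟨n, fun i => f (Pi.single i 1), fun i => LinearMap.proj i ∘ₗ g, fun x => ?_⟩
  conv_rhs => rw [← LinearMap.id_apply (R := A) x, ← hfg]
  simp_rw [← map_smul, ← map_sum]
  change f _ = f (g x)
  congr 1
  ext j
  simp [Pi.single_apply]

/-- The map sending `n` to the homomorphism `x ↦ c x • n`. -/
def rankOne {P : ModuleCat.{u} A} (c : P →ₗ[A] A) (N : ModuleCat.{u} A) :
    N →ₗ[R] (P →ₗ[A] N) where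
  toFun n := (LinearMap.toSpanSingleton A N n) ∘ₗ c
  map_add' n n' := LinearMap.ext fun x => smul_add (c x) n n'
  map_smul' r n := LinearMap.ext fun x => smul_comm (c x) r n

@[simp] theorem rankOne_apply {P : ModuleCat.{u} A} (c : P →ₗ[A] A) {N : ModuleCat.{u} A} (n : N)
    (x : P) : rankOne R c N n x = c x • n := rfl

end DualBasis

/-! ### The pairing of `DN ⊗_A M` with `Hom_A(M, N)` -/

section DualPairing

variable (R : Type u) {A : Type u} [CommRing R] [Ring A] [Algebra R A]

/-- The `R`-module underlying `D N`. -/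
def dualEquiv (N : ModuleCat.{u} A) : dual R N ≃ₗ[R] (N →ₗ[R] R) where
  toFun f := f
  invFun f := f
  map_add' _ _ := rfl
  map_smul' r f := by
    apply LinearMap.ext
    intro n
    let f' : N →ₗ[R] R := f
    change f' (algebraMap R A r • n) = r • f' n
    rw [algebraMap_smul, map_smul]
  left_inv _ := rfl
  right_inv _ := rfl

/-- Evaluation at `x`, as an `R`-linear map. -/
def homEval {M : ModuleCat.{u} A} (N : ModuleCat.{u} A) : M →ₗ[R] (M →ₗ[A] N) →ₗ[R] N :=
  LinearMap.mk₂ R (fun x h => h x) (fun x x' h => map_add h x x')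
    (fun r x h => (h.restrictScalars R).map_smul r x) (fun _ _ _ => rfl) (fun _ _ _ => rfl)

/-- The canonical map `D N ⊗_A M → D Hom_A(M, N)`. -/
def dualPairing (N M : ModuleCat.{u} A) :
    tensorOver R (dual R N) M →ₗ[R] ((M →ₗ[A] N) →ₗ[R] R) :=
  tensorLift
    (LinearMap.mk₂ R (fun (f : dual R N) (x : M) => dualEquiv R N f ∘ₗ homEval R N x)
      (fun f f' x => by rw [map_add, LinearMap.add_comp])
      (fun r f x => by rw [map_smul, LinearMap.smul_comp])
      (fun f x x' => by rw [map_add, LinearMap.comp_add])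
      (fun r f x => by rw [map_smul, LinearMap.comp_smul]))
    (fun f a x => LinearMap.ext fun h =>
      congrArg (dualEquiv R N f) (map_smul h a x).symm)

@[simp] theorem dualPairing_mk {N M : ModuleCat.{u} A} (f : dual R N) (x : M) (h : M →ₗ[A] N) :
    dualPairing R N M (tensorMk R f x) h = dualEquiv R N f (h x) := rfl

theorem dualPairing_tensorMap {N M M' : ModuleCat.{u} A} (g : M →ₗ[A] M')
    (z : tensorOver R (dual R N) M) (h : M' →ₗ[A] N) :
    dualPairing R N M' ((tensorMap R LinearMap.id g).hom z) h = dualPairing R N M z (h ∘ₗ g) := by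
  induction z using tensorOver_induction with
  | zero => simp
  | mk x y => rfl
  | add z z' hz hz' => simp only [map_add, LinearMap.add_apply, hz, hz']

/-- A dual basis `(p i, c i)` gives the inverse `ψ ↦ ∑ ψ(c i (-) • n) ⊗ p i`, the first factor being
a functional of `n`. No finiteness of `N` over `R` enters. -/
theorem dualPairing_bijective_of_projective (N P : ModuleCat.{u} A) [Module.Finite A P]
    [Module.Projective A P] : Function.Bijective (dualPairing R N P) := by
  obtain ⟨n, p, c, hpc⟩ := exists_dualBasis P
  let inv : ((P →ₗ[A] N) →ₗ[R] R) → tensorOver R (dual R N) P := fun ψ =>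
    ∑ i, tensorMk R ((dualEquiv R N).symm (ψ ∘ₗ rankOne R (c i) N)) (p i)
  have inv_add : ∀ ψ ψ', inv (ψ + ψ') = inv ψ + inv ψ' := fun ψ ψ' => by
    simp only [inv, LinearMap.add_comp, map_add, tensorMk_add_left, Finset.sum_add_distrib]
  have inv_mk : ∀ f x, inv (dualPairing R N P (tensorMk R f x)) = tensorMk R f x := fun f x => by
    conv_rhs => rw [← hpc x, tensorMk_sum_right]
    refine Finset.sum_congr rfl fun i _ => ?_
    rw [← tensorMk_smul]
    rfl
  refine Function.bijective_iff_has_inverse.2 ⟨inv, fun z => ?_, fun ψ => ?_⟩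
  · induction z using tensorOver_induction with
    | zero =>
      rw [map_zero]
      have := inv_add 0 0
      rwa [add_zero, left_eq_add] at this
    | mk f x => exact inv_mk f x
    | add z z' hz hz' => rw [map_add, inv_add, hz, hz']
  · ext h
    simp only [inv, map_sum, LinearMap.sum_apply, dualPairing_mk, LinearEquiv.apply_symm_apply,
      LinearMap.comp_apply]
    rw [← map_sum]
    congr 1
    ext x
    conv_rhs => rw [← hpc x, map_sum]
    simp [LinearMap.sum_apply]

variable {R}

theorem exists_comp_eq_of_injective_of_split {X Y : Type*} [AddCommGroup X] [Module R X]
    [AddCommGroup Y] [Module R Y] {i : X →ₗ[R] Y} {r : Y →ₗ[R] X} (h : r ∘ₗ i = LinearMap.id)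
    {Z : Type*} [AddCommGroup Z] [Module R Z] (d : X →ₗ[R] Z) : ∃ e : Y →ₗ[R] Z, e ∘ₗ i = d :=
  ⟨d ∘ₗ r, by rw [LinearMap.comp_assoc, h, LinearMap.comp_id]⟩

end DualPairing

namespace IsCostandard

variable {R A : Type u} [CommRing R] [Ring A] [Algebra R A] {Λ : Type v} [PartialOrder Λ]
  {Δ nabla : Λ → ModuleCat.{u} A}

/-- `Hom(K, N)` is projective, so `Hom(M, N)` is a summand of `Hom(P, N)`. A functional therefore
extends to `Hom(P, N)`, where it comes from a tensor. -/
theorem dualPairing_surjective (hΔ : IsSplitQuasiHereditary R A Δ)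
    (hnabla : IsCostandard R A Δ nabla) {M N : ModuleCat.{u} A}
    (hM : ExtRetractClosure Δ M) (hN : ExtRetractClosure nabla N) :
    Function.Surjective (dualPairing R N M) := by
  obtain ⟨P, π, _, _, hπ, hK⟩ := hΔ.exists_presentation hM
  have h := (isShortExact_ker hπ).precomp (X := ModuleCat.of A (LinearMap.ker π)) R
    (hnabla.ext_one hM hN)
  have := (hnabla.hom_finite_projective hK hN).2
  obtain ⟨r, hr⟩ := h.exists_retraction
  intro d
  obtain ⟨e, he⟩ := exists_comp_eq_of_injective_of_split hr d
  obtain ⟨z, rfl⟩ := (dualPairing_bijective_of_projective R N P).2 e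
  refine ⟨(tensorMap R LinearMap.id π).hom z, ?_⟩
  ext k
  rw [dualPairing_tensorMap, ← he]
  rfl

/-- Injectivity is a four lemma argument: it needs bijectivity at `P` and surjectivity at the kernel
`K`, which is again in the closure. -/
theorem dualPairing_bijective (hΔ : IsSplitQuasiHereditary R A Δ)
    (hnabla : IsCostandard R A Δ nabla) {M N : ModuleCat.{u} A}
    (hM : ExtRetractClosure Δ M) (hN : ExtRetractClosure nabla N) :
    Function.Bijective (dualPairing R N M) := by
  refine ⟨(injective_iff_map_eq_zero _).2 fun w hw => ?_, dualPairing_surjective hΔ hnabla hM hN⟩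
  obtain ⟨P, π, _, _, hπ, hK⟩ := hΔ.exists_presentation hM
  let ι : ModuleCat.of A (LinearMap.ker π) →ₗ[A] P := (LinearMap.ker π).subtype
  have h0 : IsShortExact ι π := isShortExact_ker hπ
  have h := h0.precomp R (hnabla.ext_one hM hN)
  obtain ⟨z, rfl⟩ := tensorMap_surjective (R := R)
    (f := (LinearMap.id : dual R N →ₗ[Aᵐᵒᵖ] dual R N)) Function.surjective_id hπ w
  -- The functional defined by `z` kills maps factoring through `M`, so it descends to `Hom(K, N)`.
  obtain ⟨d, hd⟩ := h.exists_desc (dualPairing R N P z) (by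
    ext k
    change dualPairing R N P z (k ∘ₗ π) = 0
    rw [← dualPairing_tensorMap, hw]
    rfl)
  obtain ⟨y, rfl⟩ := dualPairing_surjective hΔ hnabla hK hN d
  have hz : (tensorMap R LinearMap.id ι).hom y = z := by
    apply (dualPairing_bijective_of_projective R N P).1
    ext k
    rw [dualPairing_tensorMap, ← hd]
    rfl
  rw [← hz]
  exact (tensorMap_exact_right _ h0.exact hπ).apply_apply_eq_zero y

theorem tensor_finite_projective (hΔ : IsSplitQuasiHereditary R A Δ)
    (hnabla : IsCostandard R A Δ nabla) {M N : ModuleCat.{u} A}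
    (hM : ExtRetractClosure Δ M) (hN : ExtRetractClosure nabla N) :
    Module.Finite R (tensorOver R (dual R N) M) ∧
      Module.Projective R (tensorOver R (dual R N) M) := by
  obtain ⟨_, _⟩ := hnabla.hom_finite_projective hM hN
  let e := LinearEquiv.ofBijective _ (dualPairing_bijective hΔ hnabla hM hN)
  exact ⟨.equiv e.symm, .of_equiv e.symm⟩

theorem tensorMap_isShortExact (hΔ : IsSplitQuasiHereditary R A Δ)
    (hnabla : IsCostandard R A Δ nabla) {N X Y Z : ModuleCat.{u} A} {f : X →ₗ[A] Y}
    {g : Y →ₗ[A] Z} (h : IsShortExact f g) (hN : ExtRetractClosure nabla N)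
    (hX : ExtRetractClosure Δ X) (hZ : ExtRetractClosure Δ Z) :
    IsShortExact (tensorMap R (LinearMap.id : dual R N →ₗ[Aᵐᵒᵖ] dual R N) f).hom
      (tensorMap R (LinearMap.id : dual R N →ₗ[Aᵐᵒᵖ] dual R N) g).hom where
  injective := by
    refine (injective_iff_map_eq_zero _).2 fun x hx => ?_
    apply (dualPairing_bijective hΔ hnabla hX hN).1
    ext k
    -- The pairing separates points of `DN ⊗ X`, and each test map `X → N` extends to `Y`, where the
    -- image of `x` is zero.
    obtain ⟨k, rfl⟩ := h.exists_extend (hnabla.ext_one hZ hN) k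
    rw [← dualPairing_tensorMap, hx, map_zero, map_zero]
    rfl
  exact := tensorMap_exact_right _ h.exact h.surjective
  surjective := tensorMap_surjective Function.surjective_id h.surjective

end IsCostandard

/-! ### Splicing presentations into a projective resolution -/

section Resolution

variable {C : Type*} [Category* C] [Abelian C]

/-- An epimorphism in front does not change the image, and a monomorphism behind does not change the
kernel. -/
theorem exact_of_splice {X₃ X₂ X₁ K₂ K₁ : C} (π₂ : X₃ ⟶ K₂) (ι₂ : K₂ ⟶ X₂) (π₁ : X₂ ⟶ K₁)
    (ι₁ : K₁ ⟶ X₁) [Epi π₂] [Mono ι₁] (w : ι₂ ≫ π₁ = 0) (h : (ShortComplex.mk ι₂ π₁ w).Exact)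
    (w' : (π₂ ≫ ι₂) ≫ π₁ ≫ ι₁ = 0) : (ShortComplex.mk (π₂ ≫ ι₂) (π₁ ≫ ι₁) w').Exact := by
  have w'' : ι₂ ≫ π₁ ≫ ι₁ = 0 := by rw [← Category.assoc, w, Limits.zero_comp]
  let α : ShortComplex.mk (π₂ ≫ ι₂) (π₁ ≫ ι₁) w' ⟶ ShortComplex.mk ι₂ (π₁ ≫ ι₁) w'' :=
    { τ₁ := π₂
      τ₂ := 𝟙 _
      τ₃ := 𝟙 _ }
  let β : ShortComplex.mk ι₂ π₁ w ⟶ ShortComplex.mk ι₂ (π₁ ≫ ι₁) w'' :=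
    { τ₁ := 𝟙 _
      τ₂ := 𝟙 _
      τ₃ := ι₁ }
  have : Epi α.τ₁ := inferInstanceAs (Epi π₂)
  have : IsIso α.τ₂ := inferInstanceAs (IsIso (𝟙 _))
  have : Mono α.τ₃ := inferInstanceAs (Mono (𝟙 _))
  have : Epi β.τ₁ := inferInstanceAs (Epi (𝟙 _))
  have : IsIso β.τ₂ := inferInstanceAs (IsIso (𝟙 _))
  have : Mono β.τ₃ := inferInstanceAs (Mono ι₁)
  rw [ShortComplex.exact_iff_of_epi_of_isIso_of_mono α,
    ← ShortComplex.exact_iff_of_epi_of_isIso_of_mono β]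
  exact h

theorem exact_congr {X Y Z : C} {f f' : X ⟶ Y} {g g' : Y ⟶ Z} {w : f ≫ g = 0} (w' : f' ≫ g' = 0)
    (hf : f = f') (hg : g = g') (h : (ShortComplex.mk f g w).Exact) :
    (ShortComplex.mk f' g' w').Exact := by
  subst hf hg
  exact h

variable {K P : ℕ → C} (ι : ∀ n, K (n + 1) ⟶ P n) (π : ∀ n, P n ⟶ K n) (w : ∀ n, ι n ≫ π n = 0)

/-- The complex obtained by splicing the sequences `K (n + 1) → P n → K n`. -/
noncomputable def spliceComplex : ChainComplex C ℕ :=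
  ChainComplex.of P (fun n => π (n + 1) ≫ ι n) fun n => by
    rw [Category.assoc, ← Category.assoc (ι (n + 1)), w, Limits.zero_comp, Limits.comp_zero]

theorem spliceComplex_d (n : ℕ) : (spliceComplex ι π w).d (n + 1) n = π (n + 1) ≫ ι n :=
  by simp [spliceComplex]

theorem spliceComplex_map_exactAt {D : Type*} [Category* D] [Abelian D] (F : C ⥤ D) [F.Additive]
    (hF : ∀ n, ((ShortComplex.mk (ι n) (π n) (w n)).map F).ShortExact) (n : ℕ) :
    ((F.mapHomologicalComplex _).obj (spliceComplex ι π w)).ExactAt (n + 1) := by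
  rw [HomologicalComplex.exactAt_iff' _ (n + 1 + 1) (n + 1) n (by simp) (by simp)]
  have : Epi (F.map (π (n + 2))) := (hF (n + 2)).epi_g
  have : Mono (F.map (ι n)) := (hF n).mono_f
  have w' : ∀ m, F.map (ι m) ≫ F.map (π m) = 0 := fun m => by
    rw [← F.map_comp, w, F.map_zero]
  have h := exact_of_splice (F.map (π (n + 2))) (F.map (ι (n + 1))) (F.map (π (n + 1)))
    (F.map (ι n)) (w' (n + 1)) (hF (n + 1)).exact (by
      rw [Category.assoc, ← Category.assoc (F.map (ι (n + 1))), w', Limits.zero_comp,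
        Limits.comp_zero])
  have hd : ∀ m, F.map (π (m + 1)) ≫ F.map (ι m) = F.map ((spliceComplex ι π w).d (m + 1) m) :=
    fun m => ((congrArg F.map (spliceComplex_d ι π w m)).trans (F.map_comp _ _)).symm
  exact exact_congr _ (hd (n + 1)) (hd n) h

theorem spliceComplex_exactAt (h : ∀ n, (ShortComplex.mk (ι n) (π n) (w n)).ShortExact) (n : ℕ) :
    (spliceComplex ι π w).ExactAt (n + 1) := by
  rw [HomologicalComplex.exactAt_iff' _ (n + 1 + 1) (n + 1) n (by simp) (by simp)]
  have : Epi (π (n + 2)) := (h (n + 2)).epi_g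
  have : Mono (ι n) := (h n).mono_f
  have h' := exact_of_splice (π (n + 2)) (ι (n + 1)) (π (n + 1))
    (ι n) (w (n + 1)) (h (n + 1)).exact (by
      rw [Category.assoc, ← Category.assoc (ι (n + 1)), w, Limits.zero_comp, Limits.comp_zero])
  exact exact_congr _ (spliceComplex_d ι π w (n + 1)).symm (spliceComplex_d ι π w n).symm h'

theorem spliceComplex_d_comp : (spliceComplex ι π w).d 1 0 ≫ π 0 = 0 := by
  have h0 : (π 1 ≫ ι 0) ≫ π 0 = 0 := by rw [Category.assoc, w, Limits.comp_zero]
  exact (congrArg (· ≫ π 0) (spliceComplex_d ι π w 0)).trans h0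

/-- The augmentation of the spliced complex. -/
noncomputable def spliceAugmentation :
    spliceComplex ι π w ⟶ (ChainComplex.single₀ C).obj (K 0) :=
  (ChainComplex.toSingle₀Equiv _ _).symm ⟨π 0, spliceComplex_d_comp ι π w⟩

theorem spliceAugmentation_f_zero : (spliceAugmentation ι π w).f 0 = π 0 :=
  ChainComplex.toSingle₀Equiv_symm_apply_f_zero (C := spliceComplex ι π w) (π 0)
    (spliceComplex_d_comp ι π w)

/-- The projective resolution obtained by splicing presentations. -/
noncomputable def spliceResolution (h : ∀ n, (ShortComplex.mk (ι n) (π n) (w n)).ShortExact)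
    (hP : ∀ n, Projective (P n)) : ProjectiveResolution (K 0) where
  complex := spliceComplex ι π w
  projective := hP
  π := spliceAugmentation ι π w
  quasiIso := ⟨fun n => by
    cases n
    · rw [ChainComplex.quasiIsoAt₀_iff, ShortComplex.quasiIso_iff_of_zeros']
      · have : Epi (π 1) := (h 1).epi_g
        have : Epi (π 0) := (h 0).epi_g
        -- At the augmentation, the identity of `K 0` plays the role of the monomorphism in the
        -- splice.
        have h' : (ShortComplex.mk (π 1 ≫ ι 0) (π 0 ≫ 𝟙 _) (by
          rw [Category.comp_id, Category.assoc, w, Limits.comp_zero])).Exact :=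
          exact_of_splice _ _ _ _ _ (h 0).exact _
        refine ⟨exact_congr _ (spliceComplex_d ι π w 0).symm ((Category.comp_id _).trans
          (spliceAugmentation_f_zero ι π w).symm) h', ?_⟩
        change Epi ((spliceAugmentation ι π w).f 0)
        rw [spliceAugmentation_f_zero]
        exact this
      all_goals rfl
    · rw [quasiIsoAt_iff_exactAt']
      · exact spliceComplex_exactAt ι π w h _
      · apply ChainComplex.exactAt_succ_single_obj⟩

/-- `F` need only be exact on the spliced pieces: the image of the resolution then has no homology
in positive degrees. -/
theorem isZero_leftDerived_of_splice [HasProjectiveResolutions C] {D : Type*} [Category* D]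
    [Abelian D] (F : C ⥤ D) [F.Additive]
    (h : ∀ n, (ShortComplex.mk (ι n) (π n) (w n)).ShortExact) (hP : ∀ n, Projective (P n))
    (hF : ∀ n, ((ShortComplex.mk (ι n) (π n) (w n)).map F).ShortExact) (n : ℕ) :
    Limits.IsZero ((F.leftDerived (n + 1)).obj (K 0)) := by
  refine Limits.IsZero.of_iso ?_ ((spliceResolution ι π w h hP).isoLeftDerivedObj F (n + 1))
  exact (spliceComplex_map_exactAt ι π w F hF n).isZero_homology

end Resolution

/-! ### Vanishing of Tor -/

namespace IsCostandard

variable {R A : Type u} [CommRing R] [Ring A] [Algebra R A] {Λ : Type v} [PartialOrder Λ]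
  {Δ nabla : Λ → ModuleCat.{u} A}

theorem tensorLeft_map_shortExact (hΔ : IsSplitQuasiHereditary R A Δ)
    (hnabla : IsCostandard R A Δ nabla) {N : ModuleCat.{u} A} {S : ShortComplex (ModuleCat.{u} A)}
    (hS : S.ShortExact) (hN : ExtRetractClosure nabla N) (h₁ : ExtRetractClosure Δ S.X₁)
    (h₃ : ExtRetractClosure Δ S.X₃) : (S.map (tensorLeft R (dual R N))).ShortExact := by
  have h : IsShortExact S.f.hom S.g.hom :=
    ⟨hS.injective_f, (ShortComplex.ShortExact.moduleCat_exact_iff_function_exact S).1 hS.exact,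
      hS.surjective_g⟩
  have h' := hnabla.tensorMap_isShortExact hΔ h hN h₁ h₃
  exact ModuleCat.shortComplex_shortExact _ h'.exact h'.injective h'.surjective

theorem isZero_tor (hΔ : IsSplitQuasiHereditary R A Δ)
    (hnabla : IsCostandard R A Δ nabla) {M N : ModuleCat.{u} A}
    (hM : ExtRetractClosure Δ M) (hN : ExtRetractClosure nabla N) (i : ℕ) :
    Limits.IsZero (tor R (i + 1) (dual R N) M) := by
  choose P π hPf hPp hπ hK using
    fun X : {X : ModuleCat.{u} A // ExtRetractClosure Δ X} => hΔ.exists_presentation X.2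
  -- The iterated syzygies of `M`; the subtype carries closure membership through the recursion.
  let K : ℕ → {X : ModuleCat.{u} A // ExtRetractClosure Δ X} :=
    fun n => Nat.rec ⟨M, hM⟩ (fun _ X => ⟨ModuleCat.of A (LinearMap.ker (π X)), hK X⟩) n
  let ι : ∀ n, (K (n + 1)).1 ⟶ P (K n) :=
    fun n => ModuleCat.ofHom (LinearMap.ker (π (K n))).subtype
  let ρ : ∀ n, P (K n) ⟶ (K n).1 := fun n => ModuleCat.ofHom (π (K n))
  have w : ∀ n, ι n ≫ ρ n = 0 := fun n =>
    ModuleCat.hom_ext (isShortExact_ker (hπ (K n))).comp_eq_zero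
  have h : ∀ n, (ShortComplex.mk (ι n) (ρ n) (w n)).ShortExact := fun n =>
    IsShortExact.shortExact (X := ModuleCat.of A (LinearMap.ker (π (K n))))
      (isShortExact_ker (hπ (K n)))
  exact isZero_leftDerived_of_splice (K := fun n => (K n).1) ι ρ w (tensorLeft R (dual R N)) h
    (fun n => (IsProjective.iff_projective (P (K n))).1 (hPp (K n)))
    (fun n => hnabla.tensorLeft_map_shortExact hΔ (h n) hN (K (n + 1)).2 (K n).2) i

end IsCostandard

/-! ### Flatness of finitely generated projective modules -/

section Flat

variable (R : Type u) {A : Type u} [CommRing R] [Ring A] [Algebra R A]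

/-- The contraction `X ⊗_A P → X`, `x ⊗ y ↦ x (c y)`, along a functional `c`. -/
def contract (X : ModuleCat.{u} Aᵐᵒᵖ) {P : ModuleCat.{u} A} (c : P →ₗ[A] A) :
    tensorOver R X P →ₗ[R] X :=
  tensorLift
    (LinearMap.mk₂ R (fun (x : X) (y : P) => op (c y) • x)
      (fun x x' y => smul_add _ x x')
      (fun r x y => smul_comm _ r x)
      (fun x y y' => by rw [map_add, MulOpposite.op_add, add_smul])
      (fun r x y => by
        rw [show c (r • y) = r • c y from (c.restrictScalars R).map_smul r y, MulOpposite.op_smul, smul_assoc]))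
    (fun x a y => by
      change op (c y) • op a • x = op (c (a • y)) • x
      rw [map_smul, smul_eq_mul, MulOpposite.op_mul, mul_smul])

theorem contract_tensorMap {X X' : ModuleCat.{u} Aᵐᵒᵖ} {P : ModuleCat.{u} A} (c : P →ₗ[A] A)
    (f : X →ₗ[Aᵐᵒᵖ] X') (z : tensorOver R X P) :
    contract R X' c ((tensorMap R f LinearMap.id).hom z) = f (contract R X c z) := by
  induction z using tensorOver_induction with
  | zero => simp
  | mk x y => exact (map_smul f (op (c y)) x).symm
  | add z z' hz hz' => simp only [map_add, hz, hz']

/-- An element of `X ⊗ P` is recovered from its contractions along a dual basis, and contraction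
commutes with `f`. -/
theorem tensorMap_injective_of_projective {X X' : ModuleCat.{u} Aᵐᵒᵖ} {f : X →ₗ[Aᵐᵒᵖ] X'}
    (hf : Function.Injective f) (P : ModuleCat.{u} A) [Module.Finite A P] [Module.Projective A P] :
    Function.Injective (tensorMap R f (LinearMap.id : P →ₗ[A] P)).hom := by
  obtain ⟨n, p, c, hpc⟩ := exists_dualBasis P
  have key : ∀ z : tensorOver R X P, ∑ i, tensorMk R (contract R X (c i) z) (p i) = z := by
    intro z
    induction z using tensorOver_induction with
    | zero =>
      refine Finset.sum_eq_zero fun i _ => ?_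
      rw [map_zero]
      exact congrArg (Submodule.mkQ _) (TensorProduct.zero_tmul _ _)
    | mk x y =>
      conv_rhs => rw [← hpc y, tensorMk_sum_right]
      exact Finset.sum_congr rfl fun i _ => tensorMk_smul R x (c i y) (p i)
    | add z z' hz hz' =>
      simp only [map_add, tensorMk_add_left, Finset.sum_add_distrib, hz, hz']
  refine (injective_iff_map_eq_zero _).2 fun z hz => ?_
  rw [← key z]
  refine Finset.sum_eq_zero fun i _ => ?_
  have h0 : contract R X (c i) z = 0 := by
    apply hf
    rw [← contract_tensorMap, hz, map_zero, map_zero]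
  rw [h0]
  exact congrArg (Submodule.mkQ _) (TensorProduct.zero_tmul _ _)

end Flat

/-! ### Dévissage in the right module -/

section Acyclic

variable (R : Type u) {A : Type u} [CommRing R] [Ring A] [Algebra R A] {Λ : Type v}

/-- The functor `X ⊗_A -` is exact, with finitely generated projective values, on the
extension-retract closure of `Δ`. -/
structure IsTensorAcyclic (Δ : Λ → ModuleCat.{u} A) (X : ModuleCat.{u} Aᵐᵒᵖ) : Prop where
  finite_projective : ∀ M, ExtRetractClosure Δ M →
    Module.Finite R (tensorOver R X M) ∧ Module.Projective R (tensorOver R X M)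
  injective : ∀ (K P M : ModuleCat.{u} A) (f : K →ₗ[A] P) (g : P →ₗ[A] M), IsShortExact f g →
    ExtRetractClosure Δ K → ExtRetractClosure Δ M →
    Function.Injective (tensorMap R (LinearMap.id : X →ₗ[Aᵐᵒᵖ] X) f).hom

variable {R} {Δ : Λ → ModuleCat.{u} A}

/-- The kernel of `X ⊗ M → Y ⊗ M` is a quotient of `Tor₁(Z, M)`. A chase through `K → P → M`
replaces Tor: it uses injectivity of `Z ⊗ K → Z ⊗ P` and flatness of `P`. -/
theorem IsTensorAcyclic.tensorMap_isShortExact [PartialOrder Λ]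
    (hΔ : IsSplitQuasiHereditary R A Δ) {X Y Z : ModuleCat.{u} Aᵐᵒᵖ} {f : X →ₗ[Aᵐᵒᵖ] Y}
    {g : Y →ₗ[Aᵐᵒᵖ] Z} (h : IsShortExact f g) (hZ : IsTensorAcyclic R Δ Z) {M : ModuleCat.{u} A}
    (hM : ExtRetractClosure Δ M) :
    IsShortExact (tensorMap R f (LinearMap.id : M →ₗ[A] M)).hom
      (tensorMap R g (LinearMap.id : M →ₗ[A] M)).hom where
  injective := by
    refine (injective_iff_map_eq_zero _).2 fun w hw => ?_
    obtain ⟨P, π, _, _, hπ, hK⟩ := hΔ.exists_presentation hM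
    let ι : ModuleCat.of A (LinearMap.ker π) →ₗ[A] P := (LinearMap.ker π).subtype
    have h0 : IsShortExact ι π := isShortExact_ker hπ
    obtain ⟨z, rfl⟩ := tensorMap_surjective (R := R)
      (f := (LinearMap.id : X →ₗ[Aᵐᵒᵖ] X)) Function.surjective_id hπ w
    have hz : (tensorMap R (LinearMap.id : Y →ₗ[Aᵐᵒᵖ] Y) π).hom
        ((tensorMap R f LinearMap.id).hom z) = 0 := by
      rw [← hw, tensorMap_comp_apply, tensorMap_comp_apply]
      rfl
    obtain ⟨y, hy⟩ := (tensorMap_exact_right Y h0.exact hπ _).1 hz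
    have hy0 : (tensorMap R g (LinearMap.id : ModuleCat.of A (LinearMap.ker π) →ₗ[A] _)).hom y
        = 0 := by
      apply hZ.injective _ _ _ ι π h0 hK hM
      rw [map_zero, tensorMap_comp_apply]
      calc (tensorMap R (LinearMap.id ∘ₗ g) (ι ∘ₗ LinearMap.id)).hom y
          = (tensorMap R g (LinearMap.id : P →ₗ[A] P)).hom
              ((tensorMap R LinearMap.id ι).hom y) := by
            rw [tensorMap_comp_apply]
            rfl
        _ = 0 := by
            rw [hy]
            exact (tensorMap_exact_left P h.exact h.surjective).apply_apply_eq_zero z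
    obtain ⟨x, rfl⟩ := (tensorMap_exact_left _ h.exact h.surjective y).1 hy0
    -- Both sides agree in `Y ⊗ P`, and `X ⊗ P` embeds there because `P` is projective.
    have hx : (tensorMap R LinearMap.id ι).hom x = z := by
      apply tensorMap_injective_of_projective R h.injective P
      rw [← hy, tensorMap_comp_apply, tensorMap_comp_apply]
      rfl
    rw [← hx]
    exact (tensorMap_exact_right X h0.exact hπ).apply_apply_eq_zero x
  exact := tensorMap_exact_left M h.exact h.surjective
  surjective := tensorMap_surjective h.surjective Function.surjective_id

theorem isTensorAcyclic_of_closure [PartialOrder Λ] (hΔ : IsSplitQuasiHereditary R A Δ)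
    {Γ : Λ → ModuleCat.{u} Aᵐᵒᵖ} (hΓ : ∀ l, IsTensorAcyclic R Δ (Γ l)) {X : ModuleCat.{u} Aᵐᵒᵖ}
    (hX : ExtRetractClosure Γ X) : IsTensorAcyclic R Δ X := by
  induction hX with
  | base l => exact hΓ l
  | zero X h =>
    have hs : ∀ M, Subsingleton (tensorOver R X M) := fun M =>
      subsingleton_of_forall_eq 0 fun z => by
        have h0 : (LinearMap.id : X →ₗ[Aᵐᵒᵖ] X) = 0 := LinearMap.ext fun x => h.elim _ _
        rw [← tensorMap_id_apply z, h0, tensorMap_zero_left_apply]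
    refine ⟨fun M _ => ?_, fun K P M f g _ _ _ => ?_⟩
    · have := hs M
      exact finite_projective_of_subsingleton R _
    · have := hs K
      exact Function.injective_of_subsingleton _
  | ext X Y Z f g hf hfg hg _ _ hX hZ =>
    have h : IsShortExact f g := ⟨hf, hfg, hg⟩
    have hex : ∀ M, ExtRetractClosure Δ M → _ := fun M hM => hZ.tensorMap_isShortExact hΔ h hM
    refine ⟨fun M hM => (hex M hM).finite_projective (hX.finite_projective M hM)
      (hZ.finite_projective M hM), fun K P M k p hkp hK hM => ?_⟩
    have hP : ExtRetractClosure Δ P := .ext K P M k p hkp.injective hkp.exact hkp.surjective hK hM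
    refine (injective_iff_map_eq_zero _).2 fun y hy => ?_
    -- The image of `y` in `Z ⊗ K` dies in `Z ⊗ P`, hence is zero, so `y` comes from `X ⊗ K`.
    obtain ⟨x, rfl⟩ := ((hex K hK).exact y).1 <| by
      apply hZ.injective K P M k p hkp hK hM
      calc (tensorMap R LinearMap.id k).hom ((tensorMap R g LinearMap.id).hom y)
          = (tensorMap R g LinearMap.id).hom ((tensorMap R LinearMap.id k).hom y) := by
            rw [tensorMap_comp_apply, tensorMap_comp_apply]
            rfl
        _ = _ := by rw [hy, map_zero, map_zero]
    -- `X ⊗ K → X ⊗ P → Y ⊗ P` is a composite of injections; the second one needs `P` in the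
    -- closure.
    have hx : x = 0 := by
      apply hX.injective K P M k p hkp hK hM
      apply (hex P hP).injective
      rw [map_zero, map_zero, ← hy, tensorMap_comp_apply, tensorMap_comp_apply]
      rfl
    rw [hx, map_zero]
  | retract X Y i p h _ hY =>
    have hip : ∀ M (z : tensorOver R X M),
        (tensorMap R p LinearMap.id).hom ((tensorMap R i LinearMap.id).hom z) = z := fun M z => by
      rw [tensorMap_comp_apply, h]
      exact tensorMap_id_apply z
    refine ⟨fun M hM => finite_projective_of_retract R
      (i := (tensorMap R i LinearMap.id).hom) (p := (tensorMap R p LinearMap.id).hom)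
      (LinearMap.ext (hip M))
      (hY.finite_projective M hM), fun K P M k q hkq hK hM => ?_⟩
    refine (injective_iff_map_eq_zero _).2 fun z hz => ?_
    rw [← hip K z]
    have h0 : (tensorMap R i LinearMap.id).hom z = 0 := by
      apply hY.injective K P M k q hkq hK hM
      calc (tensorMap R LinearMap.id k).hom ((tensorMap R i LinearMap.id).hom z)
          = (tensorMap R i LinearMap.id).hom ((tensorMap R LinearMap.id k).hom z) := by
            rw [tensorMap_comp_apply, tensorMap_comp_apply]
            rfl
        _ = _ := by rw [hz, map_zero, map_zero]
    rw [h0, map_zero]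

end Acyclic

namespace IsCostandard

variable {R A : Type u} [CommRing R] [Ring A] [Algebra R A] {Λ : Type v} [PartialOrder Λ]
  {Δ nabla : Λ → ModuleCat.{u} A}

/-- Only the generators `D∇(l)` are treated through the dual pairing, so `X` need not be recognised
as a dual. -/
theorem isTensorAcyclic (hΔ : IsSplitQuasiHereditary R A Δ)
    (hnabla : IsCostandard R A Δ nabla) {X : ModuleCat.{u} Aᵐᵒᵖ}
    (hX : ExtRetractClosure (fun l => dual R (nabla l)) X) : IsTensorAcyclic R Δ X :=
  isTensorAcyclic_of_closure hΔ (fun l =>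
    ⟨fun _ hM => hnabla.tensor_finite_projective hΔ hM (.base l),
      fun _ _ _ _ _ h hK hM =>
        (hnabla.tensorMap_isShortExact hΔ h (.base l) hK hM).injective⟩) hX

theorem isExactToProj_tensorLeft (hΔ : IsSplitQuasiHereditary R A Δ)
    (hnabla : IsCostandard R A Δ nabla) {N : ModuleCat.{u} A} (hN : ExtRetractClosure nabla N) :
    IsExactToProj (Filt R Δ) (tensorLeft R (dual R N)) :=
  ⟨fun _ hX => hnabla.tensor_finite_projective hΔ (.of_filt hX) hN,
    fun _ hS h₁ _ h₃ => hnabla.tensorLeft_map_shortExact hΔ hS hN (.of_filt h₁) (.of_filt h₃)⟩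

theorem isExactToProj_tensorRight (hΔ : IsSplitQuasiHereditary R A Δ)
    (hnabla : IsCostandard R A Δ nabla) {M : ModuleCat.{u} A} (hM : ExtRetractClosure Δ M) :
    IsExactToProj (Filt R fun l => dual R (nabla l)) (tensorRight R M) := by
  refine ⟨fun _ hX => (hnabla.isTensorAcyclic hΔ (.of_filt hX)).finite_projective M hM,
    fun S hS _ _ h₃ => ?_⟩
  have h : IsShortExact S.f.hom S.g.hom :=
    ⟨hS.injective_f, (ShortComplex.ShortExact.moduleCat_exact_iff_function_exact S).1 hS.exact,
      hS.surjective_g⟩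
  have h' := (hnabla.isTensorAcyclic hΔ (.of_filt h₃)).tensorMap_isShortExact hΔ h hM
  exact ModuleCat.shortComplex_shortExact _ h'.exact h'.injective h'.surjective

end IsCostandard

/-! ### Base change of Hom -/

section BaseChange

variable {R : Type u} {A : Type u} [CommRing R] [Ring A] [Algebra R A] (Q : Type w) [CommRing Q]
  [Algebra R Q]

theorem baseChangeMk_add_right {M : ModuleCat.{u} A} (q : Q) (m m' : M) :
    baseChangeMk (R := R) q (m + m') = baseChangeMk q m + baseChangeMk q m' :=
  TensorProduct.tmul_add q m m'

variable {Q} in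
theorem baseChange_induction {M : ModuleCat.{u} A} {motive : baseChange (R := R) Q M → Prop}
    (zero : motive 0) (mk : ∀ q m, motive (baseChangeMk q m))
    (add : ∀ z z', motive z → motive z' → motive (z + z')) (z : baseChange (R := R) Q M) :
    motive z :=
  TensorProduct.induction_on (motive := motive) z zero mk add

theorem smul_baseChangeMk_left {M : ModuleCat.{u} A} (q q' : Q) (m : M) :
    q • baseChangeMk (R := R) q' m = baseChangeMk (q * q') m := by
  change (q ⊗ₜ[R] (1 : A)) • baseChangeMk (R := R) q' m = _
  rw [smul_baseChangeMk, one_smul]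

instance baseChange_isScalarTower (M : ModuleCat.{u} A) :
    IsScalarTower R Q (baseChange (R := R) Q M) where
  smul_assoc r q z := by
    change algebraMap Q (Q ⊗[R] A) (r • q) • z
      = algebraMap R (Q ⊗[R] A) r • algebraMap Q (Q ⊗[R] A) q • z
    rw [Algebra.smul_def, map_mul, ← IsScalarTower.algebraMap_apply, mul_smul]

/-- The `Q ⊗[R] A`-linear map `Q ⊗ f`. -/
noncomputable def baseChangeMap {M N : ModuleCat.{u} A} (f : M →ₗ[A] N) :
    baseChange (R := R) Q M →ₗ[Q ⊗[R] A] baseChange (R := R) Q N where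
  toFun := (f.restrictScalars R).lTensor Q
  map_add' := map_add _
  map_smul' b z := by
    have key : ∀ z : Q ⊗[R] M, (f.restrictScalars R).lTensor Q (baseChangeAction Q M b z)
        = baseChangeAction Q N b ((f.restrictScalars R).lTensor Q z) := by
      intro z
      induction b with
      | zero => simp
      | add b b' hb hb' => simp only [map_add, LinearMap.add_apply, hb, hb']
      | tmul q a =>
        induction z with
        | zero => simp
        | add z z' hz hz' => simp only [map_add, hz, hz']
        | tmul q' m =>
          rw [baseChangeAction_tmul, LinearMap.lTensor_tmul, LinearMap.lTensor_tmul,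
            baseChangeAction_tmul]
          exact congrArg _ (map_smul f a m)
    exact key z

/-- The elements `1 ⊗ m` generate `Q ⊗ M` over `Q ⊗ A`. -/
theorem baseChange_hom_ext {M : ModuleCat.{u} A} {Z : Type*} [AddCommGroup Z]
    [Module (Q ⊗[R] A) Z] {F G : baseChange (R := R) Q M →ₗ[Q ⊗[R] A] Z}
    (h : ∀ m, F (baseChangeMk 1 m) = G (baseChangeMk 1 m)) : F = G := by
  ext z
  induction z using baseChange_induction with
  | zero => simp
  | mk q m =>
    have hq : baseChangeMk (R := R) q m = (q ⊗ₜ[R] (1 : A)) • baseChangeMk 1 m := by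
      rw [smul_baseChangeMk, mul_one, one_smul]
    rw [hq, map_smul, map_smul, h]
  | add z z' hz hz' => rw [map_add, map_add, hz, hz']

theorem baseChangeMap_surjective {M N : ModuleCat.{u} A} {f : M →ₗ[A] N}
    (hf : Function.Surjective f) : Function.Surjective (baseChangeMap (R := R) Q f) :=
  LinearMap.lTensor_surjective Q (g := f.restrictScalars R) hf

/-- The canonical map `Q ⊗ Hom_A(M, N) → Hom_{Q ⊗ A}(Q ⊗ M, Q ⊗ N)`. -/
noncomputable def homBaseChange (M N : ModuleCat.{u} A) :
    Q ⊗[R] (M →ₗ[A] N) →ₗ[Q]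
      (baseChange (R := R) Q M →ₗ[Q ⊗[R] A] baseChange (R := R) Q N) :=
  LinearMap.liftBaseChange Q
    { toFun := baseChangeMap Q
      map_add' := fun f g => baseChange_hom_ext Q fun m => baseChangeMk_add_right Q 1 (f m) (g m)
      map_smul' := fun r f => baseChange_hom_ext Q fun m => by
        change baseChangeMk 1 (r • f m) = r • baseChangeMk (R := R) (1 : Q) (f m)
        rw [← algebraMap_smul Q r (baseChangeMk (R := R) (1 : Q) (f m)), smul_baseChangeMk_left,
          mul_one]
        change (1 : Q) ⊗ₜ[R] (r • f m) = algebraMap R Q r ⊗ₜ[R] f m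
        rw [TensorProduct.tmul_smul, TensorProduct.smul_tmul', Algebra.algebraMap_eq_smul_one] }

theorem homBaseChange_tmul_mk {M N : ModuleCat.{u} A} (q q' : Q) (f : M →ₗ[A] N) (m : M) :
    homBaseChange Q M N (q ⊗ₜ[R] f) (baseChangeMk q' m) = baseChangeMk (q * q') (f m) :=
  smul_baseChangeMk_left Q q q' (f m)

theorem homBaseChange_precomp {M M' N : ModuleCat.{u} A} (g : M →ₗ[A] M')
    (t : Q ⊗[R] (M' →ₗ[A] N)) :
    homBaseChange Q M N ((precomp R g N).lTensor Q t)
      = homBaseChange Q M' N t ∘ₗ baseChangeMap Q g := by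
  refine baseChange_hom_ext Q fun m => ?_
  induction t with
  | zero => simp
  | add t t' ht ht' =>
    rw [map_add, map_add, LinearMap.add_apply, ht, ht', map_add]
    rfl
  | tmul q f =>
    change _ = homBaseChange Q M' N (q ⊗ₜ[R] f) (baseChangeMk 1 (g m))
    rw [LinearMap.lTensor_tmul, homBaseChange_tmul_mk, homBaseChange_tmul_mk]
    rfl

/-- The inverse rebuilds `F` from its values on a dual basis: each `F(1 ⊗ p i)` is pushed along `Q ⊗
rankOne (c i)`, and the results are summed. -/
theorem homBaseChange_bijective_of_projective (N P : ModuleCat.{u} A) [Module.Finite A P]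
    [Module.Projective A P] : Function.Bijective (homBaseChange (R := R) Q P N) := by
  obtain ⟨n, p, c, hpc⟩ := exists_dualBasis P
  let inv : (baseChange (R := R) Q P →ₗ[Q ⊗[R] A] baseChange (R := R) Q N) →
      Q ⊗[R] (P →ₗ[A] N) := fun F =>
    ∑ i, (rankOne R (c i) N).lTensor Q (F (baseChangeMk 1 (p i)) : baseChange (R := R) Q N)
  have inv_add : ∀ F G, inv (F + G) = inv F + inv G := fun F G => by
    simp only [inv, ← Finset.sum_add_distrib]
    exact Finset.sum_congr rfl fun i _ => map_add ((rankOne R (c i) N).lTensor Q) _ _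
  have inv_zero : inv 0 = 0 := Finset.sum_eq_zero fun i _ => map_zero _
  have key : ∀ i (z : baseChange (R := R) Q N) (x : P),
      homBaseChange Q P N ((rankOne R (c i) N).lTensor Q z) (baseChangeMk 1 x)
        = ((1 : Q) ⊗ₜ[R] c i x) • z := by
    intro i z x
    induction z using baseChange_induction with
    | zero =>
      rw [smul_zero]
      exact LinearMap.congr_fun ((congrArg _ (map_zero _)).trans (map_zero _)) _
    | mk q y =>
      rw [smul_baseChangeMk, one_mul]
      exact (homBaseChange_tmul_mk Q q 1 (rankOne R (c i) N y) x).trans (by rw [mul_one]; rfl)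
    | add z z' hz hz' =>
      rw [smul_add, ← hz, ← hz', ← LinearMap.add_apply, ← map_add]
      exact LinearMap.congr_fun (congrArg _ (map_add ((rankOne R (c i) N).lTensor Q) _ _)) _
  refine Function.bijective_iff_has_inverse.2 ⟨inv, fun t => ?_, fun F => ?_⟩
  · induction t with
    | zero => rw [map_zero, inv_zero]
    | add t t' ht ht' => rw [map_add, inv_add, ht, ht']
    | tmul q f =>
      have h1 : ∀ i, (rankOne R (c i) N).lTensor Q
          (homBaseChange Q P N (q ⊗ₜ[R] f) (baseChangeMk 1 (p i)) : baseChange (R := R) Q N)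
          = q ⊗ₜ[R] rankOne R (c i) N (f (p i)) := fun i => by
        rw [homBaseChange_tmul_mk, mul_one]
        rfl
      simp only [inv]
      rw [Finset.sum_congr rfl fun i _ => h1 i, ← TensorProduct.tmul_sum]
      congr 1
      ext x
      conv_rhs => rw [← hpc x, map_sum]
      simp [LinearMap.sum_apply]
  · refine baseChange_hom_ext Q fun x => ?_
    simp only [inv, map_sum, LinearMap.sum_apply, key]
    rw [Finset.sum_congr rfl fun i _ => (map_smul F ((1 : Q) ⊗ₜ[R] c i x)
      (baseChangeMk 1 (p i))).symm, ← map_sum]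
    congr 1
    simp only [smul_baseChangeMk, one_mul]
    conv_rhs => rw [← hpc x]
    exact (TensorProduct.tmul_sum (R := R) (1 : Q) Finset.univ fun i => c i x • p i).symm

end BaseChange

namespace IsCostandard

variable {R A : Type u} [CommRing R] [Ring A] [Algebra R A] {Λ : Type v} [PartialOrder Λ]
  {Δ nabla : Λ → ModuleCat.{u} A} (Q : Type w) [CommRing Q] [Algebra R Q]

/-- `Hom(M, N) → Hom(P, N)` is split over `R`, so it stays injective after tensoring with any `Q`,
flat or not; naturality then reduces to `P`. -/
theorem homBaseChange_injective (hΔ : IsSplitQuasiHereditary R A Δ)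
    (hnabla : IsCostandard R A Δ nabla) {M N : ModuleCat.{u} A}
    (hM : ExtRetractClosure Δ M) (hN : ExtRetractClosure nabla N) :
    Function.Injective (homBaseChange (R := R) Q M N) := by
  obtain ⟨P, π, _, _, hπ, hK⟩ := hΔ.exists_presentation hM
  have h := (isShortExact_ker hπ).precomp (X := ModuleCat.of A (LinearMap.ker π)) R
    (hnabla.ext_one hM hN)
  have := (hnabla.hom_finite_projective hK hN).2
  obtain ⟨r, hr⟩ := h.exists_retraction
  refine (injective_iff_map_eq_zero _).2 fun t ht => ?_
  have h0 : (precomp R π N).lTensor Q t = 0 := by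
    apply (homBaseChange_bijective_of_projective Q N P).1
    rw [homBaseChange_precomp, ht, map_zero, LinearMap.zero_comp]
  rw [← LinearMap.id_apply (R := R) t, ← LinearMap.lTensor_id, ← hr, LinearMap.lTensor_comp_apply,
    h0, map_zero]

theorem homBaseChange_bijective (hΔ : IsSplitQuasiHereditary R A Δ)
    (hnabla : IsCostandard R A Δ nabla) {M N : ModuleCat.{u} A}
    (hM : ExtRetractClosure Δ M) (hN : ExtRetractClosure nabla N) :
    Function.Bijective (homBaseChange (R := R) Q M N) := by
  refine ⟨homBaseChange_injective Q hΔ hnabla hM hN, fun F => ?_⟩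
  obtain ⟨P, π, _, _, hπ, hK⟩ := hΔ.exists_presentation hM
  let ι : ModuleCat.of A (LinearMap.ker π) →ₗ[A] P := (LinearMap.ker π).subtype
  have h0 : IsShortExact ι π := isShortExact_ker hπ
  have h := h0.precomp R (hnabla.ext_one hM hN)
  obtain ⟨t, ht⟩ := (homBaseChange_bijective_of_projective Q N P).2 (F ∘ₗ baseChangeMap Q π)
  -- `t` represents `F ∘ (Q ⊗ π)`, which vanishes on `Q ⊗ K`; injectivity for `K` turns this into
  -- vanishing of the restriction of `t`, and right exactness of `Q ⊗ -` then yields a preimage of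
  -- `F`.
  have htι : (precomp R ι N).lTensor Q t = 0 := by
    apply homBaseChange_injective Q hΔ hnabla hK hN
    rw [homBaseChange_precomp, ht, map_zero]
    refine baseChange_hom_ext Q fun m => ?_
    change F (baseChangeMk 1 (π (ι m))) = 0
    rw [h0.exact.apply_apply_eq_zero]
    exact (congrArg F (TensorProduct.tmul_zero _ _)).trans (map_zero F)
  obtain ⟨s, rfl⟩ := (lTensor_exact Q h.exact h.surjective t).1 htι
  refine ⟨s, ?_⟩
  rw [homBaseChange_precomp] at ht
  ext z
  obtain ⟨y, rfl⟩ := baseChangeMap_surjective Q hπ z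
  exact LinearMap.congr_fun ht y

end IsCostandard

end SplitQH

theorem mainTheorem7 {R A : Type u} [CommRing R] [IsNoetherianRing R] [Ring A] [Algebra R A]
    [Module.Finite R A] [Module.Projective R A] {Λ : Type v} [PartialOrder Λ]
    (Δ nabla : Λ → ModuleCat.{u} A)
    (hΔ : SplitQH.IsSplitQuasiHereditary R A Δ)
    (hnabla : SplitQH.IsCostandard R A Δ nabla)
    (M N : ModuleCat.{u} A) (hM : SplitQH.Filt R Δ M) (hN : SplitQH.Filt R nabla N) :
    (Module.Finite R (SplitQH.tensorOver R (SplitQH.dual R N) M) ∧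
      Module.Projective R (SplitQH.tensorOver R (SplitQH.dual R N) M)) ∧
    (∀ i : ℕ, 0 < i → Limits.IsZero (SplitQH.tor R i (SplitQH.dual R N) M)) ∧
    SplitQH.IsExactToProj (SplitQH.Filt R fun l => SplitQH.dual R (nabla l))
      (SplitQH.tensorRight R M) ∧
    SplitQH.IsExactToProj (SplitQH.Filt R Δ) (SplitQH.tensorLeft R (SplitQH.dual R N)) ∧
    ∀ (Q : Type w) [CommRing Q] [IsNoetherianRing Q] [Algebra R Q],
      ∃ e : (Q ⊗[R] (M →ₗ[A] N)) ≃ₗ[Q]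
          (SplitQH.baseChange (R := R) Q M →ₗ[Q ⊗[R] A] SplitQH.baseChange (R := R) Q N),
        ∀ (q q' : Q) (f : M →ₗ[A] N) (m : M),
          e (q ⊗ₜ[R] f) (SplitQH.baseChangeMk q' m) = SplitQH.baseChangeMk (q * q') (f m) := by
  replace hM := SplitQH.ExtRetractClosure.of_filt hM
  replace hN := SplitQH.ExtRetractClosure.of_filt hN
  refine ⟨hnabla.tensor_finite_projective hΔ hM hN, fun i hi => ?_,
    hnabla.isExactToProj_tensorRight hΔ hM, hnabla.isExactToProj_tensorLeft hΔ hN,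
    fun Q _ _ _ => ⟨.ofBijective _ (hnabla.homBaseChange_bijective Q hΔ hM hN), fun q q' f m =>
      SplitQH.homBaseChange_tmul_mk Q q q' f m⟩⟩
  obtain ⟨j, rfl⟩ := Nat.exists_eq_succ_of_ne_zero hi.ne'
  exact hnabla.isZero_tor hΔ hM hN j
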